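/- Consider a stationary economy with $n\ge 2$ goods and a continuum of ex-ante identical agents. In each period an agent receives an endowment vector $y$ drawn, independently across periods, from a finite set $\mathcal Y\subset\mathbb R^n_{++}$ with at least two elements, with probability $e(y)>0$; some $y'\in\mathcal Y$ satisfies $y'\ge y$ for all $y\in\mathcal Y$. Let $1/2<\beta<1$ and $\bar b>0$. The utility function $U:\mathbb R^n_+\to\mathbb R$ is strictly increasing, continuous, strictly concave, continuously differentiable on $\mathbb R^n_{++}$, and $\partial U(0)/\partial x_j=\infty$ for some $j$. For $p\gg0$ and $c\ge 0$ let $x^*(c,p)=\operatorname{argmax}\{U(x):x\in\mathbb R^n_+,\ p\cdot x=c\}$, and assume that for every $p\gg 0$ the function $u_p(c)=U(x^*(c,p))$ is continuously differentiable on $(0,\infty)$ with $u_p'(c)\to0$ as $c\to\infty$ and $u_p'(c)\to\infty$ as $c\to0$. For $p\gg0$ and $0<r<1$ put $\underline b=-\min_{y}p\cdot y/r$, $C(a,p)=[\underline b,\min\{a,\sum_i p_i\bar b/(1-r)^2\}]$, $\underline a=(1+r)\underline b+\min_y p\cdot y\ (=\underline b)$, $\overline a=(1+r)\sum_i p_i\bar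 b/(1-r)^2+\max_y p\cdot y$ and $A(p,r)=[\underline a,\overline a]$. An agent with wealth $a$ who consumes $x\in\mathbb R^n_+$ with $a-p\cdot x\in C(a,p)$ has next-period wealth $(1+r)(a-p\cdot x)+p\cdot y$. Let $V(a,p,r)$ be the supremum, over all strategies assigning to every finite history of wealth levels in $A(p,r)$ a feasible bundle, of the expected discounted utility $\mathbb E\sum_{t\ge1}\beta^{t-1}U(x(t))$ from initial wealth $a$. The savings policy is $$g(a,p,r)=\operatorname*{argmax}_{b\in C(a,p)}\ U(x^*(a-b,p))+\beta\sum_{y\in\mathcal Y}e(y)V((1+r)b+p\cdot y,p,r).$$ A probability measure $\mu$ on $A(p,r)$ is invariant if $\mu(D)=\int_{A(p,r)}\sum_{y}e(y)1_D((1+r)g(a,p,r)+p\cdot y)\,\mu(da)$ for all Borel $D\subseteq A(p,r)$. With $\mu(\cdot;p,r)$ the invariant measure and $\mathcal Y_i$, $e_i$ the support and the mass function of the endowment of good $i$, the excess demands are $$\zeta_i(p,r)=\int_{A(p,r)}x_i^*(a-g(a,p,r),p)\,\mu(da;p,r)-\sum_{y_i\in\mathcal Y_i}e_i(y_i)y_i\quad(1\le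 i\le n),\qquad \zeta_{n+1}(p,r)=-\int_{A(p,r)}g(a,p,r)\,\mu(da;p,r).$$ The prices $(p,r)$ are equilibrium prices if there are an optimal savings policy, an optimal demand function and an invariant probability measure on $A(p,r)$ for which the aggregate demand for each good equals its aggregate supply and aggregate savings are $0$. Fix $p\gg0$, $0<r<1$ and $\theta>0$. Then all these objects are well defined at $(p,r)$ ($x^*(c,p)$ for $c\ge0$ and $g(a,p,r)$ for $a\ge\underline a$ are single-valued, there is exactly one invariant probability measure on $A(p,r)$, and the integrals in $\zeta$ exist), and (i) $\theta g(a,p,r)=g(\theta a,\theta p,r)$ and $x^*(a-g(a,p,r),p)=x^*(\theta a-g(\theta a,\theta p,r),\theta p)$ for all $a\ge\underline a$; (ii) $\zeta_i(\theta p,r)=\zeta_i(p,r)$ for $1\le i\le n$ and $\zeta_{n+1}(\theta p,r)=\theta\,\zeta_{n+1}(p,r)$. Moreover, if $(p,r)$ are equilibrium prices, then so are $(\theta p,r)$. -/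

import Mathlib

open Set Filter Topology MeasureTheory

noncomputable section

namespace Bewley

variable {n : ℕ}

/-- The budget set `X(c, p)`: nonnegative bundles whose cost at prices `p` is `c`. -/
def budget (p : Fin n → ℝ) (c : ℝ) : Set (Fin n → ℝ) :=
  {x | 0 ≤ x ∧ p ⬝ᵥ x = c}

/-- `x` maximizes `U` over the budget set `X(c, p)`. -/
def IsOptimalBundle (U : (Fin n → ℝ) → ℝ) (p : Fin n → ℝ) (c : ℝ) (x : Fin n → ℝ) : Prop :=
  x ∈ budget p c ∧ IsMaxOn U (budget p c) x

/-- The demand function `x*(c, p)`, the maximizer of `U` over `X(c, p)`. -/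
def demand (U : (Fin n → ℝ) → ℝ) (c : ℝ) (p : Fin n → ℝ) : Fin n → ℝ :=
  Classical.epsilon (IsOptimalBundle U p c)

/-- The indirect utility `u_p(c) = U(x*(c, p))`. -/
def indirectUtility (U : (Fin n → ℝ) → ℝ) (p : Fin n → ℝ) (c : ℝ) : ℝ :=
  U (demand U c p)

/-- The standing assumption on the utility function `U : ℝⁿ₊ → ℝ` (a total function of which only
the values on the nonnegative orthant matter). Differentiability is required on the open orthant,
since a partial derivative is infinite at the origin; `U` is continuous up to the boundary. The
strict order `x < x'` on vectors means `x ≤ x'` coordinatewise and `x ≠ x'`. -/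
structure UtilityAssumption (U : (Fin n → ℝ) → ℝ) : Prop where
  strictMono : StrictMonoOn U (Ici 0)
  continuous : ContinuousOn U (Ici 0)
  contDiff : ContDiffOn ℝ 1 U {x | ∀ i, 0 < x i}
  strictConcave : StrictConcaveOn ℝ (Ici 0) U
  partial_zero : ∃ j : Fin n,
    Tendsto (fun t : ℝ => (U (Pi.single j t) - U 0) / t) (𝓝[>] 0) atTop
  indirect_contDiff : ∀ p : Fin n → ℝ, (∀ i, 0 < p i) →
    ContDiffOn ℝ 1 (indirectUtility U p) (Ioi 0)
  indirect_atTop : ∀ p : Fin n → ℝ, (∀ i, 0 < p i) →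
    Tendsto (deriv (indirectUtility U p)) atTop (𝓝 0)
  indirect_zero : ∀ p : Fin n → ℝ, (∀ i, 0 < p i) →
    Tendsto (deriv (indirectUtility U p)) (𝓝[>] 0) atTop

/-- The primitives of the economy: the finite set `Y` of endowment vectors that occur with positive
probability, their probabilities `e`, the utility function `U`, the discount factor `β` and the
constant `bbar` in the upper bound on savings. -/
structure Economy (n : ℕ) where
  two_le : 2 ≤ n
  Y : Finset (Fin n → ℝ)
  e : (Fin n → ℝ) → ℝ
  /-- Endowments do fluctuate. -/
  nontrivial : Y.Nontrivial
  e_pos : ∀ y ∈ Y, 0 < e y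
  e_sum : ∑ y ∈ Y, e y = 1
  Y_pos : ∀ y ∈ Y, ∀ i, 0 < y i
  /-- There is a largest endowment vector. -/
  exists_top : ∃ y' ∈ Y, ∀ y ∈ Y, y ≤ y'
  U : (Fin n → ℝ) → ℝ
  utility : UtilityAssumption U
  β : ℝ
  half_lt_β : 1 / 2 < β
  β_lt_one : β < 1
  bbar : ℝ
  bbar_pos : 0 < bbar

namespace Economy

variable (E : Economy n)

/-- The value of the least valuable endowment vector. -/
def minIncome (p : Fin n → ℝ) : ℝ := E.Y.inf' E.nontrivial.nonempty (fun y => p ⬝ᵥ y)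

/-- The value of the most valuable endowment vector. -/
def maxIncome (p : Fin n → ℝ) : ℝ := E.Y.sup' E.nontrivial.nonempty (fun y => p ⬝ᵥ y)

/-- The borrowing limit. -/
def borrowLimit (p : Fin n → ℝ) (r : ℝ) : ℝ := -(E.minIncome p / r)

/-- The upper bound on savings. -/
def savingsBound (p : Fin n → ℝ) (r : ℝ) : ℝ := (∑ i, p i) * E.bbar / (1 - r) ^ 2

/-- The interval `C(a, p)` of feasible savings at wealth `a`. -/
def feasibleSavings (p : Fin n → ℝ) (r a : ℝ) : Set ℝ :=
  Icc (E.borrowLimit p r) (min a (E.savingsBound p r))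

/-- The minimal wealth level. -/
def minWealth (p : Fin n → ℝ) (r : ℝ) : ℝ :=
  (1 + r) * E.borrowLimit p r + E.minIncome p

/-- The maximal wealth level. -/
def maxWealth (p : Fin n → ℝ) (r : ℝ) : ℝ :=
  (1 + r) * E.savingsBound p r + E.maxIncome p

/-- The set `A(p, r)` of possible wealth levels. -/
def wealthSet (p : Fin n → ℝ) (r : ℝ) : Set ℝ := Icc (E.minWealth p r) (E.maxWealth p r)

/-- A strategy assigns a feasible bundle to every history of wealth levels
`(a(1), …, a(t))`; here `past = [a(1), …, a(t - 1)]` and `a = a(t)`. A bundle `x` is feasible if it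
is nonnegative and leaves feasible savings `a - p · x`. -/
def IsStrategy (p : Fin n → ℝ) (r : ℝ) (π : List ℝ → ℝ → (Fin n → ℝ)) : Prop :=
  ∀ (past : List ℝ) (a : ℝ), (∀ w ∈ past, w ∈ E.wealthSet p r) → a ∈ E.wealthSet p r →
    0 ≤ π past a ∧ a - p ⬝ᵥ π past a ∈ E.feasibleSavings p r a

/-- The expected utility `t` periods ahead under `π`, given past wealth levels `past` and current
wealth `a`. Next period's wealth is `(1 + r) (a - p · x) + p · y` with probability `e y`. -/
def expectedUtility (p : Fin n → ℝ) (r : ℝ) (π : List ℝ → ℝ → (Fin n → ℝ)) :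
    ℕ → List ℝ → ℝ → ℝ
  | 0, past, a => E.U (π past a)
  | t + 1, past, a => ∑ y ∈ E.Y, E.e y *
      expectedUtility p r π t (past ++ [a]) ((1 + r) * (a - p ⬝ᵥ π past a) + p ⬝ᵥ y)

/-- The expected discounted utility `V_π(a)` of a strategy. -/
def strategyValue (p : Fin n → ℝ) (r : ℝ) (π : List ℝ → ℝ → (Fin n → ℝ)) (a : ℝ) : ℝ :=
  ∑' t : ℕ, E.β ^ t * E.expectedUtility p r π t [] a

/-- The value function `V(a, p, r)`, the supremum of `V_π(a)` over all strategies. -/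
def value (p : Fin n → ℝ) (r a : ℝ) : ℝ :=
  sSup {v | ∃ π, E.IsStrategy p r π ∧ v = E.strategyValue p r π a}

/-- The objective of an agent with wealth `a` who saves `b`. -/
def savingsObjective (p : Fin n → ℝ) (r a b : ℝ) : ℝ :=
  E.U (demand E.U (a - b) p) + E.β * ∑ y ∈ E.Y, E.e y * E.value p r ((1 + r) * b + p ⬝ᵥ y)

/-- `b` is an optimal level of savings at wealth `a`. -/
def IsOptimalSavings (p : Fin n → ℝ) (r a b : ℝ) : Prop :=
  b ∈ E.feasibleSavings p r a ∧
    IsMaxOn (E.savingsObjective p r a) (E.feasibleSavings p r a) b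

/-- The savings policy function `g(a, p, r)`. -/
def savings (a : ℝ) (p : Fin n → ℝ) (r : ℝ) : ℝ :=
  Classical.epsilon (E.IsOptimalSavings p r a)

/-- `μ` is a probability measure on `A(p, r)` that is invariant, `M μ = μ`, where `M` moves wealth
`a` to `(1 + r) g(a) + p · y` with probability `e y`. -/
structure IsInvariant (p : Fin n → ℝ) (r : ℝ) (g : ℝ → ℝ) (μ : Measure ℝ) : Prop where
  prob : IsProbabilityMeasure μ
  support : μ (E.wealthSet p r)ᶜ = 0
  invariant : ∀ D : Set ℝ, MeasurableSet D → D ⊆ E.wealthSet p r →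
    μ D = ∫⁻ a in E.wealthSet p r, ∑ y ∈ E.Y,
      ENNReal.ofReal (E.e y) * D.indicator 1 ((1 + r) * g a + p ⬝ᵥ y) ∂μ

/-- The invariant wealth distribution `μ(· ; p, r)` induced by the savings policy function. -/
def invariantDist (p : Fin n → ℝ) (r : ℝ) : Measure ℝ :=
  Classical.epsilon (E.IsInvariant p r (fun a => E.savings a p r))

/-- The support of the endowment of good `i`. -/
def marginalSupport (i : Fin n) : Finset ℝ := E.Y.image (fun y => y i)

/-- The probability that the endowment of good `i` is `v`. -/
def marginal (i : Fin n) (v : ℝ) : ℝ := ∑ y ∈ E.Y with y i = v, E.e y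

/-- The aggregate supply of good `i`. -/
def supply (i : Fin n) : ℝ := ∑ v ∈ E.marginalSupport i, E.marginal i v * v

/-- The excess demand `ζ_i(p, r)` for good `i`. -/
def excessGood (i : Fin n) (p : Fin n → ℝ) (r : ℝ) : ℝ :=
  (∫ a in E.wealthSet p r, demand E.U (a - E.savings a p r) p i ∂(E.invariantDist p r))
    - E.supply i

/-- The excess demand `ζ_{n+1}(p, r)` for savings. -/
def excessSavings (p : Fin n → ℝ) (r : ℝ) : ℝ :=
  -∫ a in E.wealthSet p r, E.savings a p r ∂(E.invariantDist p r)

/-- A competitive stationary equilibrium: at prices `(p, r)`, the savings policy `g` (a function of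
wealth) and the demand `x` (a function of expenditure) are optimal, the wealth distribution `μ` is
invariant, and the markets for all goods and for savings clear. -/
structure IsCSE (p : Fin n → ℝ) (r : ℝ) (g : ℝ → ℝ) (x : ℝ → (Fin n → ℝ)) (μ : Measure ℝ) :
    Prop where
  savings_optimal : ∀ a ∈ E.wealthSet p r, E.IsOptimalSavings p r a (g a)
  demand_optimal : ∀ a ∈ E.wealthSet p r, IsOptimalBundle E.U p (a - g a) (x (a - g a))
  invariant : E.IsInvariant p r g μ
  goods_clear : ∀ i, ∫ a in E.wealthSet p r, x (a - g a) i ∂μ = E.supply i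
  savings_clear : ∫ a in E.wealthSet p r, g a ∂μ = 0

/-- `(p, r)` are equilibrium prices. -/
def IsEquilibriumPrices (p : Fin n → ℝ) (r : ℝ) : Prop :=
  (∀ i, 0 < p i) ∧ 0 < r ∧ r < 1 ∧ ∃ g x μ, E.IsCSE p r g x μ

/-- The demand function, the savings policy function and the invariant wealth distribution at
`(p, r)` are well defined, and the integrals in the excess demand functions exist. -/
structure WellPosed (p : Fin n → ℝ) (r : ℝ) : Prop where
  demand : ∀ c, 0 ≤ c → ∃! x, IsOptimalBundle E.U p c x
  savings : ∀ a, E.minWealth p r ≤ a → ∃! b, E.IsOptimalSavings p r a b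
  dist : ∃! μ, E.IsInvariant p r (fun a => E.savings a p r) μ
  integrable_savings :
    IntegrableOn (fun a => E.savings a p r) (E.wealthSet p r) (E.invariantDist p r)
  integrable_demand : ∀ i,
    IntegrableOn (fun a => Bewley.demand E.U (a - E.savings a p r) p i) (E.wealthSet p r)
      (E.invariantDist p r)

end Economy

end Bewley

end

/-! The homogeneity claims and the well-posedness claim differ greatly in depth. If prices are
multiplied by `θ` and wealth and savings are measured in units of `θ`, then budgets, feasible sets
and the law of motion are unchanged. Dividing all observed wealth levels by `θ` (`rescale`) turns
strategies at `p` into strategies at `θ • p` with the same utility, so the values agree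
(`value_smul`), and optimal savings and invariant measures at `p` are carried to such objects at `θ
• p`. Uniqueness identifies these images with the chosen policy and distribution at `θ • p`. The
equilibrium claim needs no uniqueness, since the whole equilibrium is transported.

Well-posedness is the long part. Replacing bundles by their cost and `U` by its indirect utility
leaves a one-good problem, `SavingsProblem`. Its Bellman operator is a contraction that preserves
concavity; strict concavity of the felicity then gives exactly one optimal level of savings.
Exchange arguments show that savings and consumption are both nondecreasing in wealth, so the policy
is 1-Lipschitz and wealth evolves by finitely many random monotone continuous maps of a compact
interval.

For such maps an invariant law is a limit of laws started at the bottom. It is unique under a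
splitting condition: for some `N`, the top after `N` worst incomes is no higher than the bottom
after `N` best incomes (`existsUnique_invariant`). The two orbits converge to fixed points, which
have to be separated. Infinite marginal utility at zero keeps savings and consumption interior,
which yields Euler inequalities. If `β * R ≤ 1`, the worst-income map fixes only the bottom
(`low_fixed`); if `β * R > 1`, the best-income map can fix only the top (`high_fixed`). Either case
gives the separation (`exists_crossing`). -/

noncomputable section

/-! ### Invariant measures of random monotone maps -/

namespace RandomMaps

variable {ι : Type*} (s : Finset ι) (w : ι → ℝ) (f : ι → ℝ → ℝ)

/-- The law of `f i x` when `x` has law `μ` and, independently, `i ∈ s` has probability `w i`. -/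
def push (μ : Measure ℝ) : Measure ℝ := ∑ i ∈ s, ENNReal.ofReal (w i) • μ.map (f i)

/-- The expectation of `φ (f i a)` when `i ∈ s` has probability `w i`. -/
def transfer (φ : ℝ → ℝ) (a : ℝ) : ℝ := ∑ i ∈ s, w i * φ (f i a)

variable {s w f} {l K : ℝ}

lemma transfer_iterate_neg (φ : ℝ → ℝ) (N : ℕ) :
    (transfer s w f)^[N] (-φ) = -(transfer s w f)^[N] φ := by
  induction N with
  | zero => rfl
  | succ N ih =>
    rw [Function.iterate_succ_apply', Function.iterate_succ_apply', ih]
    funext a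
    simp [transfer]

lemma transfer_mono (hw : ∀ i ∈ s, 0 < w i) (hf : ∀ i ∈ s, Monotone (f i)) {φ : ℝ → ℝ}
    (hφ : Monotone φ) : Monotone (transfer s w f φ) := fun _ _ hab =>
  Finset.sum_le_sum fun i hi => mul_le_mul_of_nonneg_left (hφ (hf i hi hab)) (hw i hi).le

lemma transfer_iterate_mono (hw : ∀ i ∈ s, 0 < w i) (hf : ∀ i ∈ s, Monotone (f i)) {φ : ℝ → ℝ}
    (hφ : Monotone φ) (N : ℕ) : Monotone ((transfer s w f)^[N] φ) := by
  induction N with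
  | zero => exact hφ
  | succ N ih =>
    rw [Function.iterate_succ_apply']
    exact transfer_mono hw hf ih

lemma weight_le_one (hw : ∀ i ∈ s, 0 < w i) (hsum : ∑ i ∈ s, w i = 1) {j : ι} (hj : j ∈ s) :
    w j ≤ 1 :=
  hsum ▸ Finset.single_le_sum (fun i hi => (hw i hi).le) hj

/-- With probability `w j ^ N` the state `j` occurs `N` times in a row; on all other paths `φ` is
bounded by `C`. -/
lemma transfer_iterate_le (hw : ∀ i ∈ s, 0 < w i) (hsum : ∑ i ∈ s, w i = 1) {S : Set ℝ}
    (hS : ∀ i ∈ s, MapsTo (f i) S S) {φ : ℝ → ℝ} {C : ℝ} (hC : ∀ a ∈ S, φ a ≤ C) {j : ι}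
    (hj : j ∈ s) (N : ℕ) : ∀ a ∈ S,
    (transfer s w f)^[N] φ a ≤ (1 - w j ^ N) * C + w j ^ N * φ ((f j)^[N] a) := by
  have hbound : ∀ (N : ℕ), ∀ a ∈ S, (transfer s w f)^[N] φ a ≤ C := by
    intro N
    induction N with
    | zero => exact hC
    | succ N ih =>
      intro a ha
      rw [Function.iterate_succ_apply']
      calc transfer s w f ((transfer s w f)^[N] φ) a ≤ ∑ i ∈ s, w i * C :=
            Finset.sum_le_sum fun i hi =>
              mul_le_mul_of_nonneg_left (ih _ (hS i hi ha)) (hw i hi).le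
        _ = C := by rw [← Finset.sum_mul, hsum, one_mul]
  induction N with
  | zero => intro a _; simp
  | succ N ih =>
    intro a ha
    classical
    rw [Function.iterate_succ_apply', Function.iterate_succ_apply, transfer,
      ← Finset.add_sum_erase s _ hj]
    have hrest : ∑ i ∈ s.erase j, w i = 1 - w j := by
      rw [← hsum, ← Finset.add_sum_erase s _ hj]; ring
    have h1 : ∑ i ∈ s.erase j, w i * (transfer s w f)^[N] φ (f i a) ≤ (1 - w j) * C := by
      rw [← hrest, Finset.sum_mul]
      exact Finset.sum_le_sum fun i hi => mul_le_mul_of_nonneg_left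
        (hbound N _ (hS i (Finset.mem_of_mem_erase hi) ha)) (hw i (Finset.mem_of_mem_erase hi)).le
    have h2 := mul_le_mul_of_nonneg_left (ih _ (hS j hj ha)) (hw j hj).le
    rw [pow_succ]
    linarith

lemma le_transfer_iterate (hw : ∀ i ∈ s, 0 < w i) (hsum : ∑ i ∈ s, w i = 1) {S : Set ℝ}
    (hS : ∀ i ∈ s, MapsTo (f i) S S) {φ : ℝ → ℝ} {C : ℝ} (hC : ∀ a ∈ S, C ≤ φ a) {j : ι}
    (hj : j ∈ s) (N : ℕ) (a : ℝ) (ha : a ∈ S) :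
    (1 - w j ^ N) * C + w j ^ N * φ ((f j)^[N] a) ≤ (transfer s w f)^[N] φ a := by
  have h := transfer_iterate_le hw hsum hS (φ := -φ) (C := -C)
    (fun a ha => neg_le_neg (hC a ha)) hj N a ha
  rw [transfer_iterate_neg] at h
  simp only [Pi.neg_apply] at h
  linarith

/-- In each block of `N` periods, with probability at least the minimum of the two powers, the path
from `K` falls to `(f lo)^[N] K` and the path from `l` rises to `(f hi)^[N] l`. By `hcross` these
paths contribute nothing positive to the gap. -/
lemma oscillation_le (hw : ∀ i ∈ s, 0 < w i) (hsum : ∑ i ∈ s, w i = 1) (hlK : l ≤ K)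
    (hf : ∀ i ∈ s, Monotone (f i)) (hS : ∀ i ∈ s, MapsTo (f i) (Icc l K) (Icc l K))
    {lo hi : ι} (hlo : lo ∈ s) (hhi : hi ∈ s) {N : ℕ} (hcross : (f lo)^[N] K ≤ (f hi)^[N] l)
    {φ : ℝ → ℝ} (hφ : Monotone φ) (k : ℕ) :
    (transfer s w f)^[N * k] φ K - (transfer s w f)^[N * k] φ l ≤
      (1 - min (w lo ^ N) (w hi ^ N)) ^ k * (φ K - φ l) := by
  set ε := min (w lo ^ N) (w hi ^ N)
  have hε1 : ε ≤ 1 := (min_le_left _ _).trans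
    (pow_le_one₀ (hw lo hlo).le (weight_le_one hw hsum hlo))
  induction k with
  | zero => simp
  | succ k ih =>
    rw [Nat.mul_succ, add_comm (N * k) N, Function.iterate_add_apply, pow_succ']
    set ψ := (transfer s w f)^[N * k] φ
    have hψ : Monotone ψ := transfer_iterate_mono hw hf hφ _
    have hK : K ∈ Icc l K := ⟨hlK, le_rfl⟩
    have hl : l ∈ Icc l K := ⟨le_rfl, hlK⟩
    have h1 := transfer_iterate_le hw hsum hS (φ := ψ) (fun a ha => hψ ha.2) hlo N K hK
    have h2 := le_transfer_iterate hw hsum hS (φ := ψ) (fun a ha => hψ ha.1) hhi N l hl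
    have h3 : ψ ((f lo)^[N] K) ≤ ψ K := hψ ((MapsTo.iterate (hS lo hlo) N hK).2)
    have h4 : ψ l ≤ ψ ((f hi)^[N] l) := hψ ((MapsTo.iterate (hS hi hhi) N hl).1)
    have h5 := hψ hcross
    have h6 : ε ≤ w lo ^ N := min_le_left _ _
    have h7 : ε ≤ w hi ^ N := min_le_right _ _
    have h8 : 0 ≤ ε := le_min (pow_nonneg (hw lo hlo).le _) (pow_nonneg (hw hi hhi).le _)
    have h9 := mul_le_mul_of_nonneg_left ih (sub_nonneg.2 hε1)
    nlinarith [mul_nonneg (sub_nonneg.2 h6) (sub_nonneg.2 h3),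
      mul_nonneg (sub_nonneg.2 h7) (sub_nonneg.2 h4), mul_nonneg h8 (sub_nonneg.2 h5)]

lemma integral_push {μ : Measure ℝ} [IsFiniteMeasure μ] (hw : ∀ i ∈ s, 0 < w i)
    (hf : ∀ i ∈ s, Continuous (f i)) {φ : ℝ → ℝ} (hφ : Measurable φ) {C : ℝ}
    (hC : ∀ a, |φ a| ≤ C) :
    ∫ a, φ a ∂(push s w f μ) = ∫ a, transfer s w f φ a ∂μ := by
  have hint : ∀ (ν : Measure ℝ) [IsFiniteMeasure ν], Integrable φ ν := fun ν _ =>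
    Integrable.of_bound hφ.aestronglyMeasurable C (ae_of_all _ hC)
  have hint' : ∀ i ∈ s, Integrable (fun a => φ (f i a)) μ := fun i hi =>
    Integrable.of_bound (hφ.comp (hf i hi).measurable).aestronglyMeasurable C
      (ae_of_all _ fun a => hC _)
  unfold push transfer
  rw [integral_finsetSum_measure, integral_finsetSum _ fun i hi => (hint' i hi).const_mul _]
  · refine Finset.sum_congr rfl fun i hi => ?_
    rw [integral_smul_measure, integral_map (hf i hi).aemeasurable hφ.aestronglyMeasurable,
      ENNReal.toReal_ofReal (hw i hi).le, integral_const_mul, smul_eq_mul]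
  · exact fun i _ => (hint _).smul_measure ENNReal.ofReal_ne_top

lemma abs_transfer_le (hw : ∀ i ∈ s, 0 < w i) (hsum : ∑ i ∈ s, w i = 1) {φ : ℝ → ℝ} {C : ℝ}
    (hC : ∀ a, |φ a| ≤ C) (a : ℝ) : |transfer s w f φ a| ≤ C := by
  calc |transfer s w f φ a| ≤ ∑ i ∈ s, |w i * φ (f i a)| := Finset.abs_sum_le_sum_abs _ _
    _ ≤ ∑ i ∈ s, w i * C := Finset.sum_le_sum fun i hi => by
        rw [abs_mul, abs_of_pos (hw i hi)]
        exact mul_le_mul_of_nonneg_left (hC _) (hw i hi).le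
    _ = C := by rw [← Finset.sum_mul, hsum, one_mul]

lemma integral_transfer_iterate (hw : ∀ i ∈ s, 0 < w i) (hsum : ∑ i ∈ s, w i = 1)
    (hf : ∀ i ∈ s, Monotone (f i)) (hfc : ∀ i ∈ s, Continuous (f i)) {μ : Measure ℝ}
    [IsProbabilityMeasure μ] (hμ : push s w f μ = μ) {φ : ℝ → ℝ} (hφ : Monotone φ) {C : ℝ}
    (hC : ∀ a, |φ a| ≤ C) (k : ℕ) :
    (∀ a, |(transfer s w f)^[k] φ a| ≤ C) ∧
      ∫ a, (transfer s w f)^[k] φ a ∂μ = ∫ a, φ a ∂μ := by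
  induction k with
  | zero => exact ⟨hC, rfl⟩
  | succ k ih =>
    rw [Function.iterate_succ_apply']
    refine ⟨abs_transfer_le hw hsum ih.1, ?_⟩
    rw [← integral_push hw hfc (transfer_iterate_mono hw hf hφ k).measurable ih.1, hμ, ih.2]

lemma integral_mem_Icc {μ : Measure ℝ} [IsProbabilityMeasure μ] (hμ : μ (Icc l K)ᶜ = 0)
    {φ : ℝ → ℝ} (hφ : Monotone φ) {C : ℝ} (hC : ∀ a, |φ a| ≤ C) :
    ∫ a, φ a ∂μ ∈ Icc (φ l) (φ K) := by
  have hint : Integrable φ μ :=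
    Integrable.of_bound hφ.measurable.aestronglyMeasurable C (ae_of_all _ hC)
  have hae : ∀ᵐ a ∂μ, a ∈ Icc l K := hμ
  constructor
  · calc φ l = ∫ _, φ l ∂μ := by simp
      _ ≤ _ := integral_mono_ae (integrable_const _) hint (hae.mono fun a ha => hφ ha.1)
  · calc _ ≤ ∫ _, φ K ∂μ :=
          integral_mono_ae hint (integrable_const _) (hae.mono fun a ha => hφ ha.2)
      _ = φ K := by simp

/-- The integral of a monotone `φ` against either invariant measure equals that of its iterated
transfer, hence lies between the values of that transfer at `l` and `K`. Their difference tends to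
zero by `oscillation_le`. -/
lemma invariant_unique (hw : ∀ i ∈ s, 0 < w i) (hsum : ∑ i ∈ s, w i = 1) (hlK : l ≤ K)
    (hf : ∀ i ∈ s, Monotone (f i)) (hfc : ∀ i ∈ s, Continuous (f i))
    (hS : ∀ i ∈ s, MapsTo (f i) (Icc l K) (Icc l K))
    {lo hi : ι} (hlo : lo ∈ s) (hhi : hi ∈ s) {N : ℕ} (hcross : (f lo)^[N] K ≤ (f hi)^[N] l)
    {μ ν : Measure ℝ} [IsProbabilityMeasure μ] [IsProbabilityMeasure ν]
    (hμS : μ (Icc l K)ᶜ = 0) (hνS : ν (Icc l K)ᶜ = 0)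
    (hμ : push s w f μ = μ) (hν : push s w f ν = ν) : μ = ν := by
  refine Measure.ext_of_Iic μ ν fun t => ?_
  -- Upper rays are used because their indicators are increasing.
  suffices h : μ (Ioi t) = ν (Ioi t) by
    rw [← compl_Ioi, prob_compl_eq_one_sub measurableSet_Ioi, h,
      prob_compl_eq_one_sub measurableSet_Ioi]
  set φ : ℝ → ℝ := (Ioi t).indicator 1 with hφdef
  have hφ : Monotone φ := by
    intro a b hab
    by_cases h : t < a
    · simp [φ, h, h.trans_le hab]
    · simp only [φ, indicator, mem_Ioi, h, if_false]
      split_ifs <;> simp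
  have hC : ∀ a, |φ a| ≤ 1 := by
    intro a
    simp only [φ, indicator]
    split_ifs <;> simp
  set ε := min (w lo ^ N) (w hi ^ N)
  have hε0 : 0 < ε := lt_min (pow_pos (hw lo hlo) _) (pow_pos (hw hi hhi) _)
  have hε1 : ε ≤ 1 := (min_le_left _ _).trans
    (pow_le_one₀ (hw lo hlo).le (weight_le_one hw hsum hlo))
  have key : ∀ k : ℕ, |∫ a, φ a ∂μ - ∫ a, φ a ∂ν| ≤ (1 - ε) ^ k * (φ K - φ l) := by
    intro k
    have h := oscillation_le hw hsum hlK hf hS hlo hhi hcross hφ k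
    have hm := transfer_iterate_mono hw hf hφ (N * k)
    obtain ⟨b1, e1⟩ := integral_transfer_iterate hw hsum hf hfc hμ hφ hC (N * k)
    obtain ⟨-, e2⟩ := integral_transfer_iterate hw hsum hf hfc hν hφ hC (N * k)
    have i1 := integral_mem_Icc hμS hm b1
    have i2 := integral_mem_Icc hνS hm b1
    rw [e1] at i1
    rw [e2] at i2
    rw [abs_le]
    constructor <;> linarith [i1.1, i1.2, i2.1, i2.2]
  have hlim : Tendsto (fun k : ℕ => (1 - ε) ^ k * (φ K - φ l)) atTop (𝓝 (0 * (φ K - φ l))) :=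
    (tendsto_pow_atTop_nhds_zero_of_lt_one (by linarith) (by linarith)).mul_const _
  rw [zero_mul] at hlim
  have h0 : |∫ a, φ a ∂μ - ∫ a, φ a ∂ν| ≤ 0 := ge_of_tendsto' hlim key
  have heq := sub_eq_zero.1 (abs_nonpos_iff.1 h0)
  rw [hφdef, integral_indicator_one measurableSet_Ioi, integral_indicator_one measurableSet_Ioi]
    at heq
  rwa [measureReal_eq_measureReal_iff] at heq

/-- The preimage of a closed lower ray under a monotone continuous function. -/
lemma preimage_Iic_cases {h : ℝ → ℝ} (hm : Monotone h) (hc : Continuous h) (t : ℝ) :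
    h ⁻¹' Iic t = ∅ ∨ h ⁻¹' Iic t = univ ∨ ∃ c, h ⁻¹' Iic t = Iic c := by
  rcases (h ⁻¹' Iic t).eq_empty_or_nonempty with h0 | hne
  · exact Or.inl h0
  by_cases hb : BddAbove (h ⁻¹' Iic t)
  · refine Or.inr (Or.inr ⟨sSup (h ⁻¹' Iic t), ?_⟩)
    have hmem := (isClosed_Iic.preimage hc).csSup_mem hne hb
    ext a
    exact ⟨fun ha => le_csSup hb ha, fun ha => (hm ha).trans hmem⟩
  · refine Or.inr (Or.inl (eq_univ_of_forall fun a => ?_))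
    obtain ⟨b, hb, hab⟩ := not_bddAbove_iff.1 hb a
    exact (hm hab.le).trans hb

lemma push_apply (hfc : ∀ i ∈ s, Continuous (f i)) (μ : Measure ℝ) {D : Set ℝ}
    (hD : MeasurableSet D) :
    push s w f μ D = ∑ i ∈ s, ENNReal.ofReal (w i) * μ (f i ⁻¹' D) := by
  rw [push, Measure.finsetSum_apply]
  refine Finset.sum_congr rfl fun i hi => ?_
  rw [Measure.smul_apply, Measure.map_apply (hfc i hi).measurable hD, smul_eq_mul]

lemma isProbabilityMeasure_push (hw : ∀ i ∈ s, 0 < w i) (hsum : ∑ i ∈ s, w i = 1)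
    (hfc : ∀ i ∈ s, Continuous (f i)) (μ : Measure ℝ) [IsProbabilityMeasure μ] :
    IsProbabilityMeasure (push s w f μ) := by
  constructor
  rw [push_apply hfc μ MeasurableSet.univ]
  simp only [preimage_univ, measure_univ, mul_one]
  rw [← ENNReal.ofReal_sum_of_nonneg fun i hi => (hw i hi).le, hsum, ENNReal.ofReal_one]

lemma push_compl_Icc (hS : ∀ i ∈ s, ∀ a, f i a ∈ Icc l K) (hfc : ∀ i ∈ s, Continuous (f i))
    (μ : Measure ℝ) : push s w f μ (Icc l K)ᶜ = 0 := by
  rw [push_apply hfc μ measurableSet_Icc.compl]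
  refine Finset.sum_eq_zero fun i hi => ?_
  have : f i ⁻¹' (Icc l K)ᶜ = ∅ := by
    ext a; simpa using hS i hi a
  rw [this, measure_empty, mul_zero]

/-- The Dirac mass at `l` is stochastically smallest on the interval and `push` preserves the
stochastic order, so the distribution functions of its iterates decrease pointwise. Their infimum is
the distribution function of the invariant law. Convergence holds at every point, and preimages of
lower rays are again lower rays or trivial, so the invariance equation passes to the limit without
weak convergence. -/
lemma exists_invariant (hw : ∀ i ∈ s, 0 < w i) (hsum : ∑ i ∈ s, w i = 1) (hlK : l ≤ K)
    (hf : ∀ i ∈ s, Monotone (f i)) (hfc : ∀ i ∈ s, Continuous (f i))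
    (hS : ∀ i ∈ s, ∀ a, f i a ∈ Icc l K) :
    ∃ μ : Measure ℝ, IsProbabilityMeasure μ ∧ push s w f μ = μ := by
  set ρ : ℕ → Measure ℝ := fun k => (push s w f)^[k] (Measure.dirac l) with hρ
  have hρs : ∀ k, ρ (k + 1) = push s w f (ρ k) := fun k => Function.iterate_succ_apply' _ _ _
  have hprob : ∀ k, IsProbabilityMeasure (ρ k) := by
    intro k
    induction k with
    | zero => exact Measure.dirac.isProbabilityMeasure
    | succ k ih => rw [hρs]; exact isProbabilityMeasure_push hw hsum hfc _
  have hsupp : ∀ k, ρ k (Icc l K)ᶜ = 0 := by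
    intro k
    cases k with
    | zero =>
      show Measure.dirac l _ = 0
      rw [Measure.dirac_apply' _ measurableSet_Icc.compl]
      simp [hlK]
    | succ k => rw [hρs]; exact push_compl_Icc hS hfc _
  set F : ℕ → ℝ → ℝ := fun k t => (ρ k).real (Iic t) with hF
  have hF0 : ∀ k t, 0 ≤ F k t := fun k t => measureReal_nonneg
  have hF1 : ∀ k t, F k t ≤ 1 := fun k t => measureReal_le_one
  have hFmono : ∀ k, Monotone (F k) := fun k a b hab =>
    measureReal_mono (Iic_subset_Iic.2 hab)
  have hFlow : ∀ k, ∀ t < l, F k t = 0 := by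
    intro k t ht
    have : (ρ k) (Iic t) = 0 := measure_mono_null
      (fun a ha => fun h : a ∈ Icc l K => absurd (h.1.trans ha) (not_le.2 ht)) (hsupp k)
    simp [hF, measureReal_def, this]
  have hFhigh : ∀ k, ∀ t, K ≤ t → F k t = 1 := by
    intro k t ht
    have h0 : (ρ k) (Iic t)ᶜ = 0 := measure_mono_null
      (fun a ha => fun h : a ∈ Icc l K => ha (h.2.trans ht)) (hsupp k)
    have h1 : (ρ k) (Iic t) = 1 := (prob_compl_eq_zero_iff measurableSet_Iic).1 h0
    simp [hF, measureReal_def, h1]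
  have hstep : ∀ k t, F (k + 1) t = ∑ i ∈ s, w i * (ρ k).real (f i ⁻¹' Iic t) := by
    intro k t
    simp only [hF, measureReal_def]
    rw [hρs, push_apply hfc _ measurableSet_Iic, ENNReal.toReal_sum]
    · refine Finset.sum_congr rfl fun i hi => ?_
      rw [ENNReal.toReal_mul, ENNReal.toReal_ofReal (hw i hi).le]
    · exact fun i _ => ENNReal.mul_ne_top ENNReal.ofReal_ne_top (measure_ne_top _ _)
  have hanti : ∀ k t, F (k + 1) t ≤ F k t := by
    intro k
    induction k with
    | zero =>
      intro t
      rcases lt_or_ge t l with h | h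
      · rw [hFlow _ t h, hFlow _ t h]
      · have : F 0 t = 1 := by
          have : ρ 0 (Iic t) = 1 := by
            show Measure.dirac l _ = 1
            rw [Measure.dirac_apply' _ measurableSet_Iic]
            simp [h]
          simp [hF, measureReal_def, this]
        rw [this]; exact hF1 _ _
    | succ k ih =>
      intro t
      rw [hstep, hstep]
      refine Finset.sum_le_sum fun i hi => mul_le_mul_of_nonneg_left ?_ (hw i hi).le
      rcases preimage_Iic_cases (hf i hi) (hfc i hi) t with h | h | ⟨c, h⟩
      · simp [h]
      · simp [h]
      · rw [h]; exact ih c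
  have hbdd : ∀ t, BddBelow (range fun k => F k t) := fun t =>
    ⟨0, by rintro _ ⟨k, rfl⟩; exact hF0 k t⟩
  set G : ℝ → ℝ := fun t => ⨅ k, F k t with hG
  have hGle : ∀ k t, G t ≤ F k t := fun k t => ciInf_le (hbdd t) k
  have hlim : ∀ t, Tendsto (fun k => F k t) atTop (𝓝 (G t)) := fun t =>
    tendsto_atTop_ciInf (antitone_nat_of_succ_le fun k => hanti k t) (hbdd t)
  have hGmono : Monotone G := fun a b hab => ciInf_mono (hbdd a) fun k => hFmono k hab
  have hGright : ∀ t, ContinuousWithinAt G (Ici t) t := by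
    intro t
    rw [Metric.continuousWithinAt_iff']
    intro ε hε
    -- An infimum of right-continuous functions is upper semicontinuous from the right; monotonicity
    -- of `G` supplies the other inequality.
    obtain ⟨k, hk⟩ := exists_lt_of_ciInf_lt (show G t < G t + ε by linarith)
    have hk : F k t < G t + ε := hk
    have hcont : ContinuousWithinAt (F k) (Ici t) t := by
      have := (ProbabilityTheory.cdf (ρ k)).right_continuous t
      have hfe : F k = ProbabilityTheory.cdf (ρ k) := by
        funext x; rw [ProbabilityTheory.cdf_eq_real]
      rw [hfe]; exact this
    have hev := hcont.eventually_lt_const hk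
    filter_upwards [hev, self_mem_nhdsWithin] with x hx hxt
    rw [Real.dist_eq, abs_of_nonneg (sub_nonneg.2 (hGmono hxt))]
    linarith [hGle k x]
  let St : StieltjesFunction ℝ := ⟨G, hGmono, hGright⟩
  have hGlow : ∀ t < l, G t = 0 := fun t ht => by simp [hG, hFlow _ t ht]
  have hGhigh : ∀ t, K ≤ t → G t = 1 := fun t ht => by simp [hG, hFhigh _ t ht]
  have hbot : Tendsto St atBot (𝓝 0) := by
    refine tendsto_const_nhds.congr' ?_
    filter_upwards [Iio_mem_atBot l] with t ht using (hGlow t ht).symm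
  have htop : Tendsto St atTop (𝓝 1) := by
    refine tendsto_const_nhds.congr' ?_
    filter_upwards [Ici_mem_atTop K] with t ht using (hGhigh t ht).symm
  have hμ : IsProbabilityMeasure St.measure := St.isProbabilityMeasure hbot htop
  have hIic : ∀ t, St.measure (Iic t) = ENNReal.ofReal (G t) := fun t => by
    rw [St.measure_Iic hbot, sub_zero]
  refine ⟨St.measure, hμ, ?_⟩
  have := isProbabilityMeasure_push hw hsum hfc St.measure
  refine Measure.ext_of_Iic _ _ fun t => ?_
  rw [push_apply hfc _ measurableSet_Iic]
  have hpre : ∀ i ∈ s, Tendsto (fun k => (ρ k).real (f i ⁻¹' Iic t)) atTop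
      (𝓝 (St.measure.real (f i ⁻¹' Iic t))) := by
    intro i hi
    rcases preimage_Iic_cases (hf i hi) (hfc i hi) t with h | h | ⟨c, h⟩
    · simp [h]
    · simp [h]
    · have hc := hlim c
      rw [h, measureReal_def, hIic, ENNReal.toReal_ofReal (le_ciInf fun k => hF0 k c)]
      exact hc
  have hl2 : Tendsto (fun k => F (k + 1) t) atTop
      (𝓝 (∑ i ∈ s, w i * St.measure.real (f i ⁻¹' Iic t))) := by
    simp only [hstep]
    exact tendsto_finsetSum _ fun i hi => (hpre i hi).const_mul _
  have heq := tendsto_nhds_unique hl2 ((tendsto_add_atTop_iff_nat 1).2 (hlim t))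
  rw [hIic, ← heq, ENNReal.ofReal_sum_of_nonneg fun i hi =>
    mul_nonneg (hw i hi).le measureReal_nonneg]
  refine Finset.sum_congr rfl fun i hi => ?_
  rw [ENNReal.ofReal_mul (hw i hi).le, ofReal_measureReal]

/-- Finitely many random monotone continuous maps of an interval that satisfy the splitting
condition have exactly one invariant probability measure. -/
theorem existsUnique_invariant (hw : ∀ i ∈ s, 0 < w i) (hsum : ∑ i ∈ s, w i = 1) (hlK : l ≤ K)
    (hf : ∀ i ∈ s, Monotone (f i)) (hfc : ∀ i ∈ s, Continuous (f i))
    (hS : ∀ i ∈ s, ∀ a, f i a ∈ Icc l K)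
    {lo hi : ι} (hlo : lo ∈ s) (hhi : hi ∈ s) {N : ℕ} (hcross : (f lo)^[N] K ≤ (f hi)^[N] l) :
    ∃! μ : Measure ℝ, IsProbabilityMeasure μ ∧ μ (Icc l K)ᶜ = 0 ∧ push s w f μ = μ := by
  obtain ⟨μ, h1, h2⟩ := exists_invariant hw hsum hlK hf hfc hS
  refine ⟨μ, ⟨h1, ?_, h2⟩, ?_⟩
  · rw [← h2]; exact push_compl_Icc hS hfc μ
  · rintro ν ⟨h3, h4, h5⟩
    refine invariant_unique hw hsum hlK hf hfc (fun i hi a _ => hS i hi a) hlo hhi hcross h4 ?_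
      h5 h2
    rw [← h2]; exact push_compl_Icc hS hfc μ

end RandomMaps

/-! ### Exchange inequalities for concave functions -/

lemma ConcaveOn.add_le_add_shift {S : Set ℝ} {f : ℝ → ℝ} (hf : ConcaveOn ℝ S f) {x y d : ℝ}
    (hx : x ∈ S) (hy : y ∈ S) (hxy : x < y) (hd0 : 0 ≤ d) (hd : d ≤ y - x) :
    f x + f y ≤ f (x + d) + f (y - d) := by
  have hpos : 0 < y - x := sub_pos.2 hxy
  have ht0 : 0 ≤ d / (y - x) := div_nonneg hd0 hpos.le
  have ht1 : d / (y - x) ≤ 1 := (div_le_one hpos).2 hd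
  have hdm : d / (y - x) * (y - x) = d := div_mul_cancel₀ _ hpos.ne'
  set t := d / (y - x)
  have h1 := hf.2 hx hy (sub_nonneg.2 ht1) ht0 (by ring)
  have h2 := hf.2 hx hy ht0 (sub_nonneg.2 ht1) (by ring)
  simp only [smul_eq_mul] at h1 h2
  rw [show (1 - t) * x + t * y = x + d by rw [← hdm]; ring] at h1
  rw [show t * x + (1 - t) * y = y - d by rw [← hdm]; ring] at h2
  linarith

lemma StrictConcaveOn.add_lt_add_shift {S : Set ℝ} {f : ℝ → ℝ} (hf : StrictConcaveOn ℝ S f)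
    {x y d : ℝ} (hx : x ∈ S) (hy : y ∈ S) (hd0 : 0 < d) (hd : d < y - x) :
    f x + f y < f (x + d) + f (y - d) := by
  have hpos : 0 < y - x := hd0.trans hd
  have ht0 : 0 < d / (y - x) := div_pos hd0 hpos
  have ht1 : d / (y - x) < 1 := (div_lt_one hpos).2 hd
  have hdm : d / (y - x) * (y - x) = d := div_mul_cancel₀ _ hpos.ne'
  set t := d / (y - x)
  have hne : x ≠ y := (sub_pos.1 hpos).ne
  have h1 := hf.2 hx hy hne (sub_pos.2 ht1) ht0 (by ring)
  have h2 := hf.2 hx hy hne ht0 (sub_pos.2 ht1) (by ring)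
  simp only [smul_eq_mul] at h1 h2
  rw [show (1 - t) * x + t * y = x + d by rw [← hdm]; ring] at h1
  rw [show t * x + (1 - t) * y = y - d by rw [← hdm]; ring] at h2
  linarith

/-! ### The one-good savings problem -/

/-- A savings problem with one good: the felicity of consumption `u`, the gross interest rate `R`,
savings between `l` and `B`, and income `q i` with probability `w i`. Wealth `l` is kept forever
if income is always lowest and nothing is consumed. -/
structure SavingsProblem (ι : Type*) where
  s : Finset ι
  w : ι → ℝ
  q : ι → ℝ
  u : ℝ → ℝ
  β : ℝ
  R : ℝ
  l : ℝ
  B : ℝ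
  lo : ι
  hi : ι
  w_pos : ∀ i ∈ s, 0 < w i
  w_sum : ∑ i ∈ s, w i = 1
  lo_mem : lo ∈ s
  hi_mem : hi ∈ s
  q_lo : ∀ i ∈ s, q lo ≤ q i
  q_hi : ∀ i ∈ s, q i ≤ q hi
  lo_lt_hi : q lo < q hi
  β_pos : 0 < β
  β_lt_one : β < 1
  one_lt_R : 1 < R
  l_lt_B : l < B
  l_fixed : R * l + q lo = l
  u_mono : StrictMonoOn u (Ici 0)
  u_cont : ContinuousOn u (Ici 0)
  u_conc : StrictConcaveOn ℝ (Ici 0) u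
  u_diff : ∀ c, 0 < c → DifferentiableAt ℝ u c
  u_steep : Tendsto (deriv u) (𝓝[>] 0) atTop

namespace SavingsProblem

variable {ι : Type*} (P : SavingsProblem ι)

/-- The maximal wealth. -/
def top : ℝ := P.R * P.B + P.q P.hi

/-- Feasible savings at wealth `a`. -/
def feasible (a : ℝ) : Set ℝ := Icc P.l (min a P.B)

/-- The expectation of `W` at next period's wealth after saving `b`. -/
def expect (W : ℝ → ℝ) (b : ℝ) : ℝ := ∑ i ∈ P.s, P.w i * W (P.R * b + P.q i)

/-- The value of saving `b` at wealth `a` with continuation value `W`. -/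
def objective (W : ℝ → ℝ) (a b : ℝ) : ℝ := P.u (a - b) + P.β * P.expect W b

lemma R_pos : 0 < P.R := one_pos.trans P.one_lt_R

lemma l_lt_top : P.l < P.top := by
  have h1 := mul_lt_mul_of_pos_left P.l_lt_B P.R_pos
  have h2 := P.lo_lt_hi
  have h3 := P.l_fixed
  unfold top
  linarith

lemma next_mem {b : ℝ} (hb : b ∈ Icc P.l P.B) {i : ι} (hi : i ∈ P.s) :
    P.R * b + P.q i ∈ Icc P.l P.top := by
  have h1 := mul_le_mul_of_nonneg_left hb.1 P.R_pos.le
  have h2 := mul_le_mul_of_nonneg_left hb.2 P.R_pos.le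
  have h3 := P.q_lo i hi
  have h4 := P.q_hi i hi
  have h5 := P.l_fixed
  constructor
  · linarith
  · unfold top; linarith

variable {P}

lemma mem_feasible {a b : ℝ} : b ∈ P.feasible a ↔ P.l ≤ b ∧ b ≤ a ∧ b ≤ P.B := by
  simp [feasible]

lemma feasible_subset {a b : ℝ} (hb : b ∈ P.feasible a) : b ∈ Icc P.l P.B :=
  ⟨hb.1, hb.2.trans (min_le_right _ _)⟩

lemma l_mem_feasible {a : ℝ} (ha : P.l ≤ a) : P.l ∈ P.feasible a :=
  mem_feasible.2 ⟨le_rfl, ha, P.l_lt_B.le⟩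

lemma expect_mono {W W' : ℝ → ℝ} {b b' : ℝ}
    (h : ∀ i ∈ P.s, W (P.R * b + P.q i) ≤ W' (P.R * b' + P.q i)) :
    P.expect W b ≤ P.expect W' b' :=
  Finset.sum_le_sum fun i hi => mul_le_mul_of_nonneg_left (h i hi) (P.w_pos i hi).le

lemma expect_concaveOn {W : ℝ → ℝ} (hW : ConcaveOn ℝ (Icc P.l P.top) W) :
    ConcaveOn ℝ (Icc P.l P.B) (P.expect W) := by
  refine ⟨convex_Icc _ _, fun x hx y hy a b ha hb hab => ?_⟩
  simp only [expect, smul_eq_mul, Finset.mul_sum]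
  rw [← Finset.sum_add_distrib]
  refine Finset.sum_le_sum fun i hi => ?_
  have h := hW.2 (P.next_mem hx hi) (P.next_mem hy hi) ha hb hab
  simp only [smul_eq_mul] at h
  rw [show a * (P.R * x + P.q i) + b * (P.R * y + P.q i) = P.R * (a * x + b * y) + P.q i by
    linear_combination (P.q i) * hab] at h
  have := mul_le_mul_of_nonneg_left h (P.w_pos i hi).le
  linarith

lemma objective_strictConcaveOn {W : ℝ → ℝ} (hW : ConcaveOn ℝ (Icc P.l P.top) W) (a : ℝ) :
    StrictConcaveOn ℝ (P.feasible a) (P.objective W a) := by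
  refine ⟨convex_Icc _ _, fun x hx y hy hne s t hs ht hst => ?_⟩
  have h1 := P.u_conc.2 (x := a - x) (y := a - y) (sub_nonneg.2 (mem_feasible.1 hx).2.1)
    (sub_nonneg.2 (mem_feasible.1 hy).2.1) (fun h => hne (by linarith)) hs ht hst
  have h2 := (expect_concaveOn hW).2 (feasible_subset hx) (feasible_subset hy) hs.le ht.le hst
  simp only [smul_eq_mul] at h1 h2
  rw [show s * (a - x) + t * (a - y) = a - (s * x + t * y) by linear_combination a * hst] at h1
  have h3 := mul_le_mul_of_nonneg_left h2 P.β_pos.le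
  simp only [objective, smul_eq_mul]
  linarith

lemma objective_continuousOn {W : ℝ → ℝ} (hW : ContinuousOn W (Icc P.l P.top)) (a : ℝ) :
    ContinuousOn (P.objective W a) (P.feasible a) := by
  refine ContinuousOn.add ?_ (continuousOn_const.mul ?_)
  · exact P.u_cont.comp (by fun_prop) fun b hb => sub_nonneg.2 (mem_feasible.1 hb).2.1
  · refine continuousOn_finsetSum _ fun i hi => continuousOn_const.mul ?_
    exact hW.comp (by fun_prop) fun b hb => P.next_mem (feasible_subset hb) hi

/-! ### The Bellman operator and its fixed point -/

variable (P)

/-- The Bellman operator. -/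
def bellman (W : C(Icc P.l P.top, ℝ)) : C(Icc P.l P.top, ℝ) where
  -- Savings are truncated at `a` so that the supremum runs over an interval independent of `a`, and
  -- continuity in `a` follows from compactness. The `max 0` makes the integrand continuous
  -- everywhere without changing its values.
  toFun a := sSup ((fun b : ℝ => P.u (max 0 ((a : ℝ) - min b (a : ℝ))) +
    P.β * P.expect (IccExtend P.l_lt_top.le W) (min b (a : ℝ))) '' Icc P.l P.B)
  continuous_toFun := by
    refine isCompact_Icc.continuous_sSup (Continuous.add ?_ (continuous_const.mul ?_))
    · exact P.u_cont.comp_continuous (by fun_prop) fun _ => mem_Ici.2 (le_max_left _ _)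
    · refine continuous_finsetSum _ fun i _ => continuous_const.mul ?_
      exact (W.continuous.Icc_extend' (h := P.l_lt_top.le)).comp (by fun_prop)

variable {P}

lemma bellman_isGreatest (W : C(Icc P.l P.top, ℝ)) (a : Icc P.l P.top) :
    IsGreatest (P.objective (IccExtend P.l_lt_top.le W) a '' P.feasible a) (P.bellman W a) := by
  have himg : P.objective (IccExtend P.l_lt_top.le W) a '' P.feasible a =
      (fun b : ℝ => P.u (max 0 ((a : ℝ) - min b (a : ℝ))) +
        P.β * P.expect (IccExtend P.l_lt_top.le W) (min b (a : ℝ))) '' Icc P.l P.B := by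
    ext v
    constructor
    · rintro ⟨b, hb, rfl⟩
      have hba := (mem_feasible.1 hb).2.1
      refine ⟨b, feasible_subset hb, ?_⟩
      simp only [min_eq_left hba, max_eq_right (sub_nonneg.2 hba), objective]
    · rintro ⟨b, hb, rfl⟩
      refine ⟨min b a, mem_feasible.2 ⟨le_min hb.1 a.2.1, min_le_right _ _,
        (min_le_left _ _).trans hb.2⟩, ?_⟩
      simp only [max_eq_right (sub_nonneg.2 (min_le_right b (a : ℝ))), objective]
  have hc : IsCompact (P.objective (IccExtend P.l_lt_top.le W) a '' P.feasible a) :=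
    isCompact_Icc.image_of_continuousOn
      (objective_continuousOn (W.continuous.Icc_extend' (h := P.l_lt_top.le)).continuousOn a)
  have := hc.isGreatest_sSup ⟨_, mem_image_of_mem _ (l_mem_feasible a.2.1)⟩
  rw [himg] at this ⊢
  exact this

/-- The choice that is optimal for `W` is also available with continuation `W'`, where it loses at
most the discounted distance. -/
lemma bellman_le (W W' : C(Icc P.l P.top, ℝ)) (a : Icc P.l P.top) :
    P.bellman W a ≤ P.bellman W' a + P.β * dist W W' := by
  obtain ⟨b, hb, he⟩ := (bellman_isGreatest W a).1
  have h2 := (bellman_isGreatest W' a).2 (mem_image_of_mem _ hb)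
  rw [← he]
  have h3 : P.expect (IccExtend P.l_lt_top.le W) b ≤
      P.expect (IccExtend P.l_lt_top.le W') b + dist W W' := by
    calc _ ≤ P.expect (fun x => IccExtend P.l_lt_top.le W' x + dist W W') b := by
          refine expect_mono fun i _ => ?_
          have := ContinuousMap.dist_apply_le_dist (f := W) (g := W')
            (projIcc P.l P.top P.l_lt_top.le (P.R * b + P.q i))
          rw [Real.dist_eq] at this
          have := (abs_le.1 this).2
          simp only [IccExtend, Function.comp_apply]
          linarith
      _ = _ := by
          simp only [expect, mul_add, Finset.sum_add_distrib, ← Finset.sum_mul, P.w_sum, one_mul]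
  have h4 := mul_le_mul_of_nonneg_left h3 P.β_pos.le
  simp only [objective] at h2 ⊢
  linarith

lemma bellman_contracting : ContractingWith P.β.toNNReal P.bellman := by
  refine ⟨Real.toNNReal_lt_one.2 P.β_lt_one, LipschitzWith.of_dist_le_mul fun W W' => ?_⟩
  rw [Real.coe_toNNReal _ P.β_pos.le, ContinuousMap.dist_le (mul_nonneg P.β_pos.le dist_nonneg)]
  intro a
  rw [Real.dist_eq, abs_le]
  have h1 := bellman_le W W' a
  have h2 := bellman_le W' W a
  rw [dist_comm W' W] at h2
  constructor <;> linarith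

/-- A convex combination of optimal savings at two wealth levels is feasible at the combined wealth.
-/
lemma bellman_concaveOn {W : C(Icc P.l P.top, ℝ)}
    (hW : ConcaveOn ℝ (Icc P.l P.top) (IccExtend P.l_lt_top.le W)) :
    ConcaveOn ℝ (Icc P.l P.top) (IccExtend P.l_lt_top.le (P.bellman W)) := by
  refine ⟨convex_Icc _ _, fun x hx y hy s t hs ht hst => ?_⟩
  have hz := convex_Icc P.l P.top hx hy hs ht hst
  rw [IccExtend_of_mem _ _ hx, IccExtend_of_mem _ _ hy, IccExtend_of_mem _ _ hz]
  obtain ⟨b, hb, he⟩ := (bellman_isGreatest W ⟨x, hx⟩).1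
  obtain ⟨b', hb', he'⟩ := (bellman_isGreatest W ⟨y, hy⟩).1
  rw [← he, ← he']
  simp only at hb hb'
  rw [mem_feasible] at hb hb'
  have hm : s * b + t * b' ∈ P.feasible (s • x + t • y) := by
    rw [mem_feasible]
    simp only [smul_eq_mul]
    have hB := convex_Icc P.l P.B (x := b) (y := b') ⟨hb.1, hb.2.2⟩ ⟨hb'.1, hb'.2.2⟩ hs ht hst
    refine ⟨hB.1, ?_, hB.2⟩
    have := mul_le_mul_of_nonneg_left hb.2.1 hs
    have := mul_le_mul_of_nonneg_left hb'.2.1 ht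
    linarith
  refine le_trans ?_ ((bellman_isGreatest W ⟨_, hz⟩).2 (mem_image_of_mem _ hm))
  have h1 := P.u_conc.concaveOn.2 (x := x - b) (y := y - b') (sub_nonneg.2 hb.2.1)
    (sub_nonneg.2 hb'.2.1) hs ht hst
  have h2 := (expect_concaveOn hW).2 (x := b) (y := b') ⟨hb.1, hb.2.2⟩ ⟨hb'.1, hb'.2.2⟩ hs ht hst
  have h3 := mul_le_mul_of_nonneg_left h2 P.β_pos.le
  simp only [smul_eq_mul] at h1 h2 h3
  simp only [objective, smul_eq_mul]
  rw [show s * x + t * y - (s * b + t * b') = s * (x - b) + t * (y - b') by ring]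
  linarith

variable (P)

/-- `W` is a continuous concave solution of the Bellman equation. -/
structure IsValue (W : ℝ → ℝ) : Prop where
  cont : ContinuousOn W (Icc P.l P.top)
  conc : ConcaveOn ℝ (Icc P.l P.top) W
  bellman : ∀ a ∈ Icc P.l P.top, IsGreatest (P.objective W a '' P.feasible a) (W a)

theorem exists_isValue : ∃ W, P.IsValue W := by
  have : Nonempty C(Icc P.l P.top, ℝ) := ⟨0⟩
  set W := ContractingWith.fixedPoint P.bellman bellman_contracting
  have hfix : P.bellman W = W := ContractingWith.fixedPoint_isFixedPt bellman_contracting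
  refine ⟨IccExtend P.l_lt_top.le W, (W.continuous.Icc_extend').continuousOn, ?_, ?_⟩
  · have hit : ∀ n : ℕ, ConcaveOn ℝ (Icc P.l P.top)
        (IccExtend P.l_lt_top.le (P.bellman^[n] 0)) := by
      intro n
      induction n with
      | zero =>
        refine (concaveOn_const 0 (convex_Icc _ _)).congr fun x hx => ?_
        simp [IccExtend]
      | succ n ih =>
        rw [Function.iterate_succ_apply']
        exact bellman_concaveOn ih
    have hlim : ∀ x, Tendsto (fun n => IccExtend P.l_lt_top.le (P.bellman^[n] 0) x) atTop
        (𝓝 (IccExtend P.l_lt_top.le W x)) := fun x =>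
      ((continuous_eval_const (projIcc P.l P.top P.l_lt_top.le x)).tendsto W).comp
        (bellman_contracting.tendsto_iterate_fixedPoint 0)
    refine ⟨convex_Icc _ _, fun x hx y hy s t hs ht hst => ?_⟩
    exact le_of_tendsto_of_tendsto' (((hlim x).const_smul s).add ((hlim y).const_smul t)) (hlim _)
      fun n => (hit n).2 hx hy hs ht hst
  · intro a ha
    have h := bellman_isGreatest W ⟨a, ha⟩
    rw [hfix] at h
    rwa [IccExtend_of_mem _ _ ha]

/-- `g` is a policy that is optimal for the continuation value `W`. -/
def IsPolicy (W g : ℝ → ℝ) : Prop :=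
  ∀ a, P.l ≤ a → g a ∈ P.feasible a ∧ IsMaxOn (P.objective W a) (P.feasible a) (g a)

/-! ### Uniqueness and monotonicity of optimal policies -/

variable {P} {W g : ℝ → ℝ}

/-- Wealth above `top` is allowed: savings are capped by `B`, so next period's wealth lies in the
domain of `W` anyway. -/
lemma IsValue.existsUnique_max (hW : P.IsValue W) {a : ℝ} (ha : P.l ≤ a) :
    ∃! b, b ∈ P.feasible a ∧ IsMaxOn (P.objective W a) (P.feasible a) b := by
  obtain ⟨b, hb, hmax⟩ := isCompact_Icc.exists_isMaxOn ⟨_, l_mem_feasible ha⟩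
    (objective_continuousOn hW.cont a)
  exact ⟨b, ⟨hb, hmax⟩, fun b' h' =>
    (objective_strictConcaveOn hW.conc a).eq_of_isMaxOn h'.2 hmax h'.1 hb⟩

lemma IsPolicy.lt (hW : P.IsValue W) (hg : P.IsPolicy W g) {a b : ℝ} (hb : b ∈ P.feasible a)
    (hne : b ≠ g a) : P.objective W a b < P.objective W a (g a) := by
  have ha : P.l ≤ a := hb.1.trans (mem_feasible.1 hb).2.1
  obtain ⟨h1, h2⟩ := hg a ha
  refine lt_of_le_of_ne (h2 hb) fun h => hne ?_
  refine (objective_strictConcaveOn hW.conc a).eq_of_isMaxOn (fun x hx => ?_) h2 hb h1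
  exact (h2 hx).trans h.ge

lemma IsPolicy.value_eq (hW : P.IsValue W) (hg : P.IsPolicy W g) {a : ℝ}
    (ha : a ∈ Icc P.l P.top) : W a = P.objective W a (g a) := by
  obtain ⟨h1, h2⟩ := hg a ha.1
  obtain ⟨b, hb, he⟩ := (hW.bellman a ha).1
  refine le_antisymm ?_ ((hW.bellman a ha).2 (mem_image_of_mem _ h1))
  rw [← he]
  exact h2 hb

/-- If the richer agent saved less, exchanging the two savings levels would be feasible. It would
leave total continuation value unchanged and bring the two consumption levels closer together,
contradicting optimality. -/
lemma IsPolicy.savings_mono (hW : P.IsValue W) (hg : P.IsPolicy W g) {a a' : ℝ} (ha : P.l ≤ a)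
    (haa : a ≤ a') : g a ≤ g a' := by
  by_contra! hlt
  rcases haa.eq_or_lt with rfl | haa'
  · exact lt_irrefl _ hlt
  have h1 := mem_feasible.1 (hg a ha).1
  have h2 := mem_feasible.1 (hg a' (ha.trans haa)).1
  have h3 := hg.lt hW (a := a) (b := g a') (mem_feasible.2 ⟨h2.1, by linarith, h2.2.2⟩) hlt.ne
  have h4 := hg.lt hW (a := a') (b := g a) (mem_feasible.2 ⟨h1.1, by linarith, h1.2.2⟩) hlt.ne'
  have h5 := P.u_conc.add_lt_add_shift (x := a - g a) (y := a' - g a') (d := g a - g a')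
    (sub_nonneg.2 h1.2.1) (sub_nonneg.2 h2.2.1) (by linarith) (by linarith)
  rw [show a - g a + (g a - g a') = a - g a' by ring,
    show a' - g a' - (g a - g a') = a' - g a by ring] at h5
  simp only [objective] at h3 h4
  linarith

/-- The dual exchange: swapping consumption levels moves the two savings levels towards each other,
and the concave continuation value does not lose. -/
lemma IsPolicy.consumption_mono (hW : P.IsValue W) (hg : P.IsPolicy W g) {a a' : ℝ}
    (ha : P.l ≤ a) (haa : a ≤ a') : a - g a ≤ a' - g a' := by
  by_contra! hlt
  have h1 := mem_feasible.1 (hg a ha).1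
  have h2 := mem_feasible.1 (hg a' (ha.trans haa)).1
  rcases haa.eq_or_lt with rfl | haa'
  · exact lt_irrefl _ hlt
  have h3 := hg.lt hW (a := a) (b := g a' - (a' - a))
    (mem_feasible.2 ⟨by linarith, by linarith, by linarith⟩) (by linarith)
  have h4 := hg.lt hW (a := a') (b := g a + (a' - a))
    (mem_feasible.2 ⟨by linarith, by linarith, by linarith⟩) (by linarith)
  have h5 := (expect_concaveOn hW.conc).add_le_add_shift (x := g a) (y := g a') (d := a' - a)
    ⟨h1.1, h1.2.2⟩ ⟨h2.1, h2.2.2⟩ (by linarith) (by linarith) (by linarith)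
  have h6 := mul_le_mul_of_nonneg_left h5 P.β_pos.le
  simp only [objective] at h3 h4
  rw [show a - (g a' - (a' - a)) = a' - g a' by ring] at h3
  rw [show a' - (g a + (a' - a)) = a - g a by ring] at h4
  linarith

/-- Since savings and consumption both increase and add up to wealth, savings cannot grow faster
than wealth. -/
lemma IsPolicy.continuousOn (hW : P.IsValue W) (hg : P.IsPolicy W g) :
    ContinuousOn g (Ici P.l) := by
  have : LipschitzOnWith 1 g (Ici P.l) := by
    refine LipschitzOnWith.of_le_add fun x hx y hy => ?_
    rcases le_total x y with h | h
    · exact (hg.savings_mono hW hx h).trans (le_add_of_nonneg_right dist_nonneg)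
    · have := hg.consumption_mono hW hy h
      rw [Real.dist_eq, abs_of_nonneg (sub_nonneg.2 h)]
      linarith
  exact this.continuousOn

lemma IsValue.mono (hW : P.IsValue W) {x z : ℝ} (hx : x ∈ Icc P.l P.top)
    (hz : z ∈ Icc P.l P.top) (hxz : x ≤ z) : W x ≤ W z := by
  obtain ⟨b, hb, he⟩ := (hW.bellman x hx).1
  rw [mem_feasible] at hb
  refine le_trans ?_ ((hW.bellman z hz).2
    (mem_image_of_mem _ (mem_feasible.2 ⟨hb.1, hb.2.1.trans hxz, hb.2.2⟩)))
  rw [← he]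
  have := P.u_mono.monotoneOn (a := x - b) (b := z - b) (sub_nonneg.2 hb.2.1)
    (sub_nonneg.2 (hb.2.1.trans hxz)) (by linarith)
  simp only [objective]
  linarith

end SavingsProblem

/-! ### One-sided maxima and orbits of monotone maps -/

lemma HasDerivAt.nonpos_of_eventually_le {ψ : ℝ → ℝ} {d : ℝ} (h : HasDerivAt ψ d 0)
    (hle : ∀ᶠ t in 𝓝[>] 0, ψ t ≤ ψ 0) : d ≤ 0 := by
  have h1 := (hasDerivAt_iff_tendsto_slope_zero.1 h).mono_left (nhdsGT_le_nhdsNE 0)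
  refine le_of_tendsto h1 ?_
  filter_upwards [hle, self_mem_nhdsWithin] with t ht ht0
  rw [zero_add, smul_eq_mul]
  exact mul_nonpos_of_nonneg_of_nonpos (inv_nonneg.2 (le_of_lt ht0)) (sub_nonpos.2 ht)

lemma Monotone.tendsto_iterate_of_map_le {f : ℝ → ℝ} (hf : Monotone f) (hc : Continuous f)
    {l x : ℝ} (hl : ∀ a, l ≤ f a) (hlx : l ≤ x) (hx : f x ≤ x) :
    ∃ z, l ≤ z ∧ z ≤ x ∧ f z = z ∧ Tendsto (fun n => f^[n] x) atTop (𝓝 z) := by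
  have hanti : Antitone fun n => f^[n] x := hf.antitone_iterate_of_map_le hx
  have hlow : ∀ n, l ≤ f^[n] x := by
    intro n
    cases n with
    | zero => exact hlx
    | succ n => rw [Function.iterate_succ_apply']; exact hl _
  have hlim := tendsto_atTop_ciInf hanti ⟨l, by rintro _ ⟨n, rfl⟩; exact hlow n⟩
  exact ⟨_, le_ciInf hlow,
    _root_.le_of_tendsto hlim (Eventually.of_forall fun n => hanti (Nat.zero_le n)),
    isFixedPt_of_tendsto_iterate hlim hc.continuousAt, hlim⟩

lemma Monotone.tendsto_iterate_of_le_map {f : ℝ → ℝ} (hf : Monotone f) (hc : Continuous f)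
    {K x : ℝ} (hK : ∀ a, f a ≤ K) (hxK : x ≤ K) (hx : x ≤ f x) :
    ∃ z, x ≤ z ∧ z ≤ K ∧ f z = z ∧ Tendsto (fun n => f^[n] x) atTop (𝓝 z) := by
  have hmono : Monotone fun n => f^[n] x := hf.monotone_iterate_of_le_map hx
  have hup : ∀ n, f^[n] x ≤ K := by
    intro n
    cases n with
    | zero => exact hxK
    | succ n => rw [Function.iterate_succ_apply']; exact hK _
  have hlim := tendsto_atTop_ciSup hmono ⟨K, by rintro _ ⟨n, rfl⟩; exact hup n⟩
  exact ⟨_,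
    _root_.ge_of_tendsto hlim (Eventually.of_forall fun n => hmono (Nat.zero_le n)), ciSup_le hup,
    isFixedPt_of_tendsto_iterate hlim hc.continuousAt, hlim⟩

/-! ### Interiority of savings and consumption -/

namespace SavingsProblem

variable {ι : Type*} {P : SavingsProblem ι} {W g : ℝ → ℝ}

/-- The mean value theorem turns infinite marginal utility at zero into a gain that beats any linear
cost. Both interiority results rest on this. -/
lemma not_lipschitz_at_zero (C δ : ℝ) (hδ : 0 < δ) :
    ∃ h, 0 < h ∧ h < δ ∧ C * h < P.u h - P.u 0 := by
  have hev := (P.u_steep.eventually_gt_atTop C)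
  rw [eventually_nhdsWithin_iff, Metric.eventually_nhds_iff] at hev
  obtain ⟨ε, hε, hev⟩ := hev
  have hm : 0 < min ε δ := lt_min hε hδ
  refine ⟨min ε δ / 2, half_pos hm, by linarith [min_le_right ε δ], ?_⟩
  have hh := half_pos hm
  obtain ⟨c, hc, he⟩ := exists_deriv_eq_slope P.u hh
    (P.u_cont.mono fun x hx => hx.1) fun x hx => (P.u_diff x hx.1).differentiableWithinAt
  have hcε : dist c 0 < ε := by
    rw [Real.dist_eq, sub_zero, abs_of_pos hc.1]
    linarith [hc.2, min_le_left ε δ]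
  have hd := hev hcε hc.1
  rw [he, sub_zero, lt_div_iff₀ hh] at hd
  exact hd

lemma u_deriv_strictAnti : StrictAntiOn (deriv P.u) (Ioi 0) :=
  (P.u_conc.subset Ioi_subset_Ici_self (convex_Ioi 0)).strictAntiOn_deriv
    fun x hx => P.u_diff x hx

lemma u_deriv_pos {c : ℝ} (hc : 0 < c) : 0 < deriv P.u c := by
  have h1 : 0 < slope P.u c (c + 1) := by
    rw [slope_def_field]
    refine div_pos (sub_pos.2 (P.u_mono (mem_Ici.2 hc.le) (mem_Ici.2 (by linarith)) ?_)) ?_ <;>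
      linarith
  exact h1.trans (P.u_conc.slope_lt_deriv (mem_Ici.2 hc.le) (mem_Ici.2 (by linarith))
    (by linarith) (P.u_diff c hc))

/-- A concave function on `[x, z]` has at `y ≤ z` slopes to the left that are bounded in terms of
its total increase. -/
lemma concave_sub_le {S : Set ℝ} {f : ℝ → ℝ} (hf : ConcaveOn ℝ S f) {x y z D e : ℝ} (hx : x ∈ S)
    (hz : z ∈ S) (hyz : y ≤ z) (he : 0 < e) (hxy : e ≤ y - x) (hD : f y - f x ≤ D)
    (hD0 : 0 ≤ D) : f z - f y ≤ D / e * (z - y) := by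
  rcases hyz.eq_or_lt with rfl | hlt
  · simp
  have h := hf.slope_anti_adjacent hx hz (show x < y by linarith) hlt
  have h2 : (f y - f x) / (y - x) ≤ D / e :=
    div_le_div₀ hD0 hD he hxy
  rw [div_le_iff₀ (sub_pos.2 hlt)] at h
  exact h.trans (mul_le_mul_of_nonneg_right h2 (sub_nonneg.2 hlt.le))

/-- If nothing were consumed, consuming a little would gain more than linearly. The loss is at most
linear because next period's wealth stays away from `l`, where the concave `W` could be steep. -/
lemma IsPolicy.savings_lt (hW : P.IsValue W) (hg : P.IsPolicy W g) {x : ℝ} (hx : P.l < x) :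
    g x < x := by
  obtain ⟨hgx, hmax⟩ := hg x hx.le
  rw [mem_feasible] at hgx
  refine lt_of_le_of_ne hgx.2.1 fun heq => ?_
  rw [heq] at hmax hgx
  have hlt := P.l_lt_top
  have hD0 : 0 ≤ W P.top - W P.l :=
    sub_nonneg.2 (hW.mono ⟨le_rfl, hlt.le⟩ ⟨hlt.le, le_rfl⟩ hlt.le)
  -- With `h` below half of `x - P.l`, next wealth exceeds `l` by at least `P.R * (x - P.l) / 2`;
  -- the constant bounds the slope of `W` there, times `R` and discounted.
  obtain ⟨h, h0, hδ, hC⟩ := P.not_lipschitz_at_zero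
    (P.β * ((W P.top - W P.l) / (P.R * (x - P.l) / 2) * P.R)) ((x - P.l) / 2) (by linarith)
  have hb : x - h ∈ P.feasible x := mem_feasible.2 ⟨by linarith, by linarith, by linarith⟩
  have h1 := hmax hb
  have hexp : P.expect W x ≤ P.expect (fun a => W a +
      (W P.top - W P.l) / (P.R * (x - P.l) / 2) * (P.R * h)) (x - h) := by
    refine expect_mono fun i hi => ?_
    have hm1 := P.next_mem (b := x) ⟨hx.le, hgx.2.2⟩ hi
    have hm2 := P.next_mem (feasible_subset hb) hi
    have hRh := mul_pos P.R_pos h0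
    have := concave_sub_le hW.conc (e := P.R * (x - P.l) / 2) (D := W P.top - W P.l)
      (x := P.l) (y := P.R * (x - h) + P.q i) (z := P.R * x + P.q i) ⟨le_rfl, hlt.le⟩ hm1
      (by linarith) (by have := mul_pos P.R_pos (sub_pos.2 hx); linarith) ?_ ?_ hD0
    · rw [show P.R * x + P.q i - (P.R * (x - h) + P.q i) = P.R * h by ring] at this
      linarith
    · have h3 := P.l_fixed
      have h4 := P.q_lo i hi
      have h5 := mul_le_mul_of_nonneg_left hδ.le P.R_pos.le
      linarith
    · have := hW.mono hm2 ⟨hlt.le, le_rfl⟩ hm2.2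
      linarith
  have hexp2 : P.expect (fun a => W a +
      (W P.top - W P.l) / (P.R * (x - P.l) / 2) * (P.R * h)) (x - h) = P.expect W (x - h) +
      (W P.top - W P.l) / (P.R * (x - P.l) / 2) * (P.R * h) := by
    simp only [expect, mul_add, Finset.sum_add_distrib]
    rw [← Finset.sum_mul, P.w_sum, one_mul]
  rw [hexp2] at hexp
  have h6 := mul_le_mul_of_nonneg_left hexp P.β_pos.le
  simp only [mem_ofPred_eq, objective] at h1
  rw [show x - (x - h) = h by ring, show x - x = 0 by ring] at h1
  linarith

/-- Saving only `l` would leave wealth `l` and consumption zero after the worst income. Saving `h`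
more costs a linear amount now, but allows `R * h` to be consumed in that state, which gains more
than linearly. -/
lemma IsPolicy.lt_savings (hW : P.IsValue W) (hg : P.IsPolicy W g) {x : ℝ} (hx : P.l < x) :
    P.l < g x := by
  have hlo := hg.savings_lt hW hx
  obtain ⟨hgx, hmax⟩ := hg x hx.le
  rw [mem_feasible] at hgx
  refine lt_of_le_of_ne hgx.1 fun heq => ?_
  rw [← heq] at hmax hgx hlo
  set c := x - P.l with hc
  have hc0 : 0 < c := sub_pos.2 hx
  have hlt := P.l_lt_top
  have hmono : ∀ {a b : ℝ}, 0 ≤ a → a ≤ b → P.u a ≤ P.u b := fun ha hab =>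
    P.u_mono.monotoneOn (mem_Ici.2 ha) (mem_Ici.2 (ha.trans hab)) hab
  have hwlo := P.w_pos _ P.lo_mem
  -- The constant is a bound on the marginal loss, with present consumption kept above `c / 2`,
  -- divided by the discounted probability of the worst state.
  obtain ⟨h, h0, hδ, hC⟩ := P.not_lipschitz_at_zero
    ((P.u c - P.u 0) / (c / 2) / (P.β * P.w P.lo)) (min (c / 2) (P.B - P.l))
    (lt_min (by linarith) (sub_pos.2 P.l_lt_B))
  have hδ1 : h < c / 2 := hδ.trans_le (min_le_left _ _)
  have hδ2 : h < P.B - P.l := hδ.trans_le (min_le_right _ _)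
  have hb : P.l + h ∈ P.feasible x := mem_feasible.2 ⟨by linarith, by linarith, by linarith⟩
  have h1 := hmax hb
  have hRh : h ≤ P.R * h := by nlinarith [P.one_lt_R]
  have hloss : P.u c - P.u (c - h) ≤ (P.u c - P.u 0) / (c / 2) * h := by
    have := concave_sub_le P.u_conc.concaveOn (x := 0) (y := c - h) (z := c) (e := c / 2)
      (D := P.u c - P.u 0) (mem_Ici.2 le_rfl) (mem_Ici.2 hc0.le) (by linarith) (by linarith)
      (by linarith) (by linarith [hmono (show 0 ≤ c - h by linarith) (show c - h ≤ c by linarith)])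
      (by linarith [hmono le_rfl hc0.le])
    rwa [show c - (c - h) = h by ring] at this
  have hgain : P.w P.lo * (P.u h - P.u 0) ≤ P.expect W (P.l + h) - P.expect W P.l := by
    unfold expect
    rw [← Finset.sum_sub_distrib]
    have hterm : ∀ i ∈ P.s, 0 ≤ P.w i * W (P.R * (P.l + h) + P.q i)
        - P.w i * W (P.R * P.l + P.q i) := by
      intro i hi
      rw [← mul_sub]
      refine mul_nonneg (P.w_pos i hi).le (sub_nonneg.2 (hW.mono
        (P.next_mem ⟨le_rfl, P.l_lt_B.le⟩ hi) (P.next_mem (feasible_subset hb) hi) ?_))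
      nlinarith [P.one_lt_R]
    refine le_trans ?_ (Finset.single_le_sum hterm P.lo_mem)
    rw [← mul_sub]
    refine mul_le_mul_of_nonneg_left ?_ hwlo.le
    have e1 : P.R * (P.l + h) + P.q P.lo = P.l + P.R * h := by linarith [P.l_fixed]
    have m1 := P.next_mem (feasible_subset hb) P.lo_mem
    rw [e1] at m1
    rw [P.l_fixed, e1]
    have v1 := (hW.bellman _ m1).2 (mem_image_of_mem _ (l_mem_feasible m1.1))
    obtain ⟨b, hb', he⟩ := (hW.bellman P.l ⟨le_rfl, hlt.le⟩).1
    rw [mem_feasible] at hb'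
    have hbl : b = P.l := le_antisymm hb'.2.1 hb'.1
    rw [hbl] at he
    simp only [objective] at v1 he
    rw [show P.l + P.R * h - P.l = P.R * h by ring] at v1
    rw [show P.l - P.l = 0 by ring] at he
    linarith [hmono h0.le hRh]
  simp only [mem_ofPred_eq, objective] at h1
  rw [show x - (P.l + h) = c - h by rw [hc]; ring, ← hc] at h1
  rw [div_mul_eq_mul_div, div_lt_iff₀ (mul_pos P.β_pos hwlo)] at hC
  have h6 := mul_le_mul_of_nonneg_left hgain P.β_pos.le
  nlinarith

/-! ### Euler inequalities -/

/-- The felicity lost and gained when `t` more is consumed now and, in each state, `R t` less in the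
next period. -/
def variation (P : SavingsProblem ι) (g : ℝ → ℝ) (x t : ℝ) : ℝ :=
  P.u (x - g x + t) + P.β * ∑ i ∈ P.s, P.w i *
    P.u (P.R * g x + P.q i - g (P.R * g x + P.q i) - P.R * t)

lemma IsPolicy.lt_next (hW : P.IsValue W) (hg : P.IsPolicy W g) {x : ℝ} (hx : P.l < x) {i : ι}
    (hi : i ∈ P.s) : P.l < P.R * g x + P.q i := by
  have h1 := mul_lt_mul_of_pos_left (hg.lt_savings hW hx) P.R_pos
  linarith [P.l_fixed, P.q_lo i hi]

lemma IsPolicy.next_mem (hg : P.IsPolicy W g) {x : ℝ} (hx : P.l ≤ x) {i : ι} (hi : i ∈ P.s) :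
    P.R * g x + P.q i ∈ Icc P.l P.top :=
  P.next_mem (feasible_subset (hg x hx).1) hi

/-- Next period's savings are held at their old level in every state, so later periods are
unaffected and only two felicities change. -/
lemma IsPolicy.variation_le (hW : P.IsValue W) (hg : P.IsPolicy W g) {x t : ℝ}
    (hx : P.l < x) (ht : g x - t ∈ P.feasible x)
    (htc : ∀ i ∈ P.s, P.R * t ≤ P.R * g x + P.q i - g (P.R * g x + P.q i)) :
    P.variation g x t ≤ P.variation g x 0 := by
  have hmax := (hg x hx.le).2 ht
  simp only [mem_ofPred_eq, objective] at hmax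
  rw [show x - (g x - t) = x - g x + t by ring] at hmax
  have hexp : ∑ i ∈ P.s, P.w i *
      (P.u (P.R * g x + P.q i - g (P.R * g x + P.q i) - P.R * t) +
        P.β * P.expect W (g (P.R * g x + P.q i))) ≤ P.expect W (g x - t) := by
    refine Finset.sum_le_sum fun i hi => mul_le_mul_of_nonneg_left ?_ (P.w_pos i hi).le
    set f := P.R * g x + P.q i with hf
    have hm := P.next_mem (feasible_subset ht) hi
    have hfm := hg.next_mem hx.le hi
    have hfe := mem_feasible.1 (hg f hfm.1).1
    have e : P.R * (g x - t) + P.q i = f - P.R * t := by rw [hf]; ring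
    rw [e] at hm ⊢
    have := htc i hi
    refine le_trans (le_of_eq ?_) ((hW.bellman _ hm).2 (mem_image_of_mem _
      (show g f ∈ P.feasible (f - P.R * t) from mem_feasible.2 ⟨hfe.1, by linarith, hfe.2.2⟩)))
    simp only [objective]
    rw [show f - P.R * t - g f = f - g f - P.R * t by ring]
  have heq : P.expect W (g x) = ∑ i ∈ P.s, P.w i *
      (P.u (P.R * g x + P.q i - g (P.R * g x + P.q i)) +
        P.β * P.expect W (g (P.R * g x + P.q i))) :=
    Finset.sum_congr rfl fun i hi => by
      rw [hg.value_eq hW (hg.next_mem hx.le hi), objective]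
  simp only [mul_add, Finset.sum_add_distrib] at hexp heq
  rw [heq] at hmax
  have := mul_le_mul_of_nonneg_left hexp P.β_pos.le
  simp only [variation, mul_zero, sub_zero, add_zero]
  linarith

lemma IsPolicy.hasDerivAt_variation (hW : P.IsValue W) (hg : P.IsPolicy W g) {x : ℝ}
    (hx : P.l < x) : HasDerivAt (P.variation g x) (deriv P.u (x - g x) - P.β * P.R *
      ∑ i ∈ P.s, P.w i * deriv P.u (P.R * g x + P.q i - g (P.R * g x + P.q i))) 0 := by
  have h1 : HasDerivAt (fun t => P.u (x - g x + t)) (deriv P.u (x - g x)) 0 := by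
    have h := (P.u_diff _ (sub_pos.2 (hg.savings_lt hW hx))).hasDerivAt
    rw [← add_zero (x - g x)] at h
    simpa using h.comp_const_add (x - g x) 0
  have h2 : ∀ i ∈ P.s, HasDerivAt (fun t => P.w i *
      P.u (P.R * g x + P.q i - g (P.R * g x + P.q i) - P.R * t))
      (P.w i * (deriv P.u (P.R * g x + P.q i - g (P.R * g x + P.q i)) * -P.R)) 0 := by
    intro i hi
    set c := P.R * g x + P.q i - g (P.R * g x + P.q i)
    have h := (P.u_diff c (sub_pos.2 (hg.savings_lt hW (hg.lt_next hW hx hi)))).hasDerivAt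
    have hin : HasDerivAt (fun t : ℝ => c - P.R * t) (-P.R) 0 := by
      simpa using ((hasDerivAt_id (0 : ℝ)).const_mul P.R).const_sub c
    have h' : HasDerivAt P.u (deriv P.u c) (c - P.R * 0) := by simpa using h
    exact (h'.comp 0 hin).const_mul _
  refine (h1.add ((HasDerivAt.fun_sum h2).const_mul P.β)).congr_deriv ?_
  simp only [← mul_assoc, ← Finset.sum_mul]
  ring

lemma eventually_mul_le {ι : Type*} (s : Finset ι) (c : ι → ℝ) (hc : ∀ i ∈ s, 0 < c i) (k : ℝ) :
    ∀ᶠ t in 𝓝 (0 : ℝ), ∀ i ∈ s, k * t ≤ c i := by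
  rw [Filter.eventually_all_finset]
  intro i hi
  have : Tendsto (fun t : ℝ => k * t) (𝓝 0) (𝓝 0) := by
    simpa using (continuous_const_mul k).tendsto (0 : ℝ)
  exact this.eventually_le_const (hc i hi)

lemma IsPolicy.euler_le (hW : P.IsValue W) (hg : P.IsPolicy W g) {x : ℝ} (hx : P.l < x) :
    deriv P.u (x - g x) ≤ P.β * P.R *
      ∑ i ∈ P.s, P.w i * deriv P.u (P.R * g x + P.q i - g (P.R * g x + P.q i)) := by
  refine sub_nonpos.1 ((hg.hasDerivAt_variation hW hx).nonpos_of_eventually_le ?_)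
  have hl := hg.lt_savings hW hx
  have hgx := mem_feasible.1 (hg x hx.le).1
  have h1 := eventually_mul_le P.s (fun i => P.R * g x + P.q i - g (P.R * g x + P.q i))
    (fun i hi => sub_pos.2 (hg.savings_lt hW (hg.lt_next hW hx hi))) P.R
  have h2 : ∀ᶠ t in 𝓝 (0 : ℝ), t ≤ g x - P.l := eventually_le_nhds (sub_pos.2 hl)
  filter_upwards [h1.filter_mono nhdsWithin_le_nhds, h2.filter_mono nhdsWithin_le_nhds,
    self_mem_nhdsWithin] with t ht1 ht2 ht0
  have ht0 : 0 < t := ht0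
  exact hg.variation_le hW hx (mem_feasible.2 ⟨by linarith, by linarith, by linarith⟩) ht1

lemma IsPolicy.le_euler (hW : P.IsValue W) (hg : P.IsPolicy W g) {x : ℝ} (hx : P.l < x)
    (hB : g x < P.B) : P.β * P.R *
      ∑ i ∈ P.s, P.w i * deriv P.u (P.R * g x + P.q i - g (P.R * g x + P.q i)) ≤
        deriv P.u (x - g x) := by
  have hd := hg.hasDerivAt_variation hW hx
  have hneg : HasDerivAt (fun t => P.variation g x (-t)) (-(deriv P.u (x - g x) - P.β * P.R *
      ∑ i ∈ P.s, P.w i * deriv P.u (P.R * g x + P.q i - g (P.R * g x + P.q i)))) 0 := by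
    rw [← neg_zero] at hd
    exact (hd.comp (0 : ℝ) (hasDerivAt_neg 0)).congr_deriv (by ring)
  have := hneg.nonpos_of_eventually_le ?_
  · linarith
  have hl := hg.savings_lt hW hx
  have hgx := mem_feasible.1 (hg x hx.le).1
  have h2 : ∀ᶠ t in 𝓝 (0 : ℝ), t ≤ x - g x := eventually_le_nhds (sub_pos.2 hl)
  have h3 : ∀ᶠ t in 𝓝 (0 : ℝ), t ≤ P.B - g x := eventually_le_nhds (sub_pos.2 hB)
  filter_upwards [h3.filter_mono nhdsWithin_le_nhds, h2.filter_mono nhdsWithin_le_nhds,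
    self_mem_nhdsWithin] with t ht1 ht2 ht0
  have ht0 : 0 < t := ht0
  rw [neg_zero]
  refine hg.variation_le hW hx (mem_feasible.2 ⟨by linarith, by linarith, by linarith⟩) ?_
  intro i hi
  have := hg.savings_lt hW (hg.lt_next hW hx hi)
  nlinarith [P.R_pos]

lemma sum_deriv_lt {κ : ℝ} (hκ : 0 < κ) (c : ι → ℝ) (hc : ∀ i ∈ P.s, κ ≤ c i)
    (hex : ∃ i ∈ P.s, κ < c i) : ∑ i ∈ P.s, P.w i * deriv P.u (c i) < deriv P.u κ := by
  calc ∑ i ∈ P.s, P.w i * deriv P.u (c i) < ∑ i ∈ P.s, P.w i * deriv P.u κ := by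
        refine Finset.sum_lt_sum (fun i hi => ?_) ?_
        · exact mul_le_mul_of_nonneg_left (P.u_deriv_strictAnti.antitoneOn (mem_Ioi.2 hκ)
            (mem_Ioi.2 (hκ.trans_le (hc i hi))) (hc i hi)) (P.w_pos i hi).le
        · obtain ⟨i, hi, hlt⟩ := hex
          exact ⟨i, hi, mul_lt_mul_of_pos_left (P.u_deriv_strictAnti (mem_Ioi.2 hκ)
            (mem_Ioi.2 (hκ.trans hlt)) hlt) (P.w_pos i hi)⟩
    _ = deriv P.u κ := by rw [← Finset.sum_mul, P.w_sum, one_mul]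

lemma sum_deriv_nonneg (c : ι → ℝ) (hc : ∀ i ∈ P.s, 0 < c i) :
    0 ≤ ∑ i ∈ P.s, P.w i * deriv P.u (c i) :=
  Finset.sum_nonneg fun i hi => mul_nonneg (P.w_pos i hi).le (P.u_deriv_pos (hc i hi)).le

/-- Were a higher wealth fixed under the worst income, consumption could never fall from there. The
Euler inequality would then force it to be constant, and unspent interest would push wealth beyond
every bound. -/
lemma IsPolicy.low_fixed (hW : P.IsValue W) (hg : P.IsPolicy W g) (hβR : P.β * P.R ≤ 1) {x : ℝ}
    (hx : x ∈ Icc P.l P.top) (hfix : P.R * g x + P.q P.lo = x) : x = P.l := by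
  by_contra hne
  have hlx : P.l < x := lt_of_le_of_ne hx.1 (Ne.symm hne)
  set κ := x - g x with hκdef
  have hκ : 0 < κ := sub_pos.2 (hg.savings_lt hW hlx)
  -- By the Euler inequality, consumption cannot rise above `κ` from a wealth above `x` at which it
  -- is `κ` and from which wealth stays above `x`.
  have key : ∀ z, x ≤ z → z - g z = κ → (∀ i ∈ P.s, x ≤ P.R * g z + P.q i) →
      ∀ i ∈ P.s, P.R * g z + P.q i - g (P.R * g z + P.q i) = κ := by
    intro z hxz hz hnext i hi
    have hc : ∀ j ∈ P.s, κ ≤ P.R * g z + P.q j - g (P.R * g z + P.q j) := fun j hj =>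
      hg.consumption_mono hW hlx.le (hnext j hj)
    by_contra hi'
    have hlt := P.sum_deriv_lt hκ _ hc ⟨i, hi, lt_of_le_of_ne (hc i hi) (Ne.symm hi')⟩
    have he := hg.euler_le hW (hlx.trans_le hxz)
    rw [hz] at he
    have h0 := P.sum_deriv_nonneg _ fun j hj => hκ.trans_le (hc j hj)
    nlinarith
  have hnext : ∀ i ∈ P.s, x ≤ P.R * g x + P.q i := fun i hi => by linarith [P.q_lo i hi]
  -- The largest wealth `z` with consumption `κ` gives the contradiction: there `g z - g x = z - x`,
  -- so even the worst income leads to `x + R * (z - x) > z`, again with consumption `κ`.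
  set S : Set ℝ := Icc x P.top ∩ (fun z => z - g z) ⁻¹' {κ} with hS
  have hScont : ContinuousOn (fun z => z - g z) (Icc x P.top) :=
    continuousOn_id.sub ((hg.continuousOn hW).mono fun z hz => mem_Ici.2 (hlx.le.trans hz.1))
  have hSc : IsCompact S := isCompact_Icc.of_isClosed_subset
    (hScont.preimage_isClosed_of_isClosed isClosed_Icc isClosed_singleton) inter_subset_left
  have hhiS : P.R * g x + P.q P.hi ∈ S :=
    ⟨⟨hnext _ P.hi_mem, (hg.next_mem hlx.le P.hi_mem).2⟩, key x le_rfl rfl hnext _ P.hi_mem⟩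
  obtain ⟨z, hzS, hzmax⟩ := hSc.exists_isGreatest ⟨_, hhiS⟩
  have hxz : x < z := by
    have := hzmax hhiS
    linarith [P.lo_lt_hi]
  have hgz : z - g z = κ := hzS.2
  have hnextz : ∀ i ∈ P.s, z < P.R * g z + P.q i := by
    intro i hi
    have h1 : P.R * g z = P.R * g x + P.R * (z - x) := by
      rw [show g z = g x + (z - x) by linarith]; ring
    have h2 := mul_lt_mul_of_pos_right P.one_lt_R (sub_pos.2 hxz)
    linarith [P.q_lo i hi]
  have hk := key z hxz.le hgz (fun i hi => (hxz.trans (hnextz i hi)).le) _ P.lo_mem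
  have := hzmax (show P.R * g z + P.q P.lo ∈ S from
    ⟨⟨(hxz.trans (hnextz _ P.lo_mem)).le, (hg.next_mem (hlx.trans hxz).le P.lo_mem).2⟩, hk⟩)
  linarith [hnextz _ P.lo_mem]

/-- At a wealth fixed under the best income, consumption cannot rise. With savings below `B`, the
Euler inequality would demand that expected marginal utility fall, so the cap must bind. -/
lemma IsPolicy.high_fixed (hW : P.IsValue W) (hg : P.IsPolicy W g) (hβR : 1 < P.β * P.R) {x : ℝ}
    (hx : x ∈ Icc P.l P.top) (hfix : P.R * g x + P.q P.hi = x) : x = P.top := by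
  have hgx := mem_feasible.1 (hg x hx.1).1
  have hlx : P.l < x := by
    have := mul_le_mul_of_nonneg_left hgx.1 P.R_pos.le
    linarith [P.l_fixed, P.lo_lt_hi]
  rcases hgx.2.2.eq_or_lt with hB | hB
  · rw [← hfix, hB, top]
  exfalso
  have he := hg.le_euler hW hlx hB
  have hκ : 0 < x - g x := sub_pos.2 (hg.savings_lt hW hlx)
  have hsum : deriv P.u (x - g x) ≤
      ∑ i ∈ P.s, P.w i * deriv P.u (P.R * g x + P.q i - g (P.R * g x + P.q i)) := by
    calc deriv P.u (x - g x) = ∑ i ∈ P.s, P.w i * deriv P.u (x - g x) := by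
          rw [← Finset.sum_mul, P.w_sum, one_mul]
      _ ≤ _ := by
          refine Finset.sum_le_sum fun i hi => mul_le_mul_of_nonneg_left ?_ (P.w_pos i hi).le
          have hn := hg.lt_next hW hlx hi
          refine P.u_deriv_strictAnti.antitoneOn (mem_Ioi.2 (sub_pos.2 (hg.savings_lt hW hn)))
            (mem_Ioi.2 hκ) (hg.consumption_mono hW hn.le ?_)
          linarith [P.q_hi i hi]
  have hpos := P.u_deriv_pos hκ
  nlinarith

/-! ### The splitting condition and the invariant law -/

/-- Next period's wealth if the policy `g` is followed and state `i` occurs. Wealth is clamped to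
the interval `[l, top]`. -/
def next (P : SavingsProblem ι) (g : ℝ → ℝ) (i : ι) (a : ℝ) : ℝ :=
  P.R * g (max P.l (min a P.top)) + P.q i

lemma next_of_mem {i : ι} {a : ℝ} (ha : a ∈ Icc P.l P.top) :
    P.next g i a = P.R * g a + P.q i := by
  rw [next, min_eq_left ha.2, max_eq_right ha.1]

lemma IsPolicy.next_mem_Icc (hg : P.IsPolicy W g) {i : ι} (hi : i ∈ P.s) (a : ℝ) :
    P.next g i a ∈ Icc P.l P.top :=
  hg.next_mem (le_max_left _ _) hi

lemma IsPolicy.next_monotone (hW : P.IsValue W) (hg : P.IsPolicy W g) (i : ι) :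
    Monotone (P.next g i) := by
  intro a b hab
  have := hg.savings_mono hW (le_max_left P.l (min a P.top))
    (max_le_max le_rfl (min_le_min hab le_rfl) : _ ≤ max P.l (min b P.top))
  have := mul_le_mul_of_nonneg_left this P.R_pos.le
  simp only [next]
  linarith

lemma IsPolicy.next_continuous (hW : P.IsValue W) (hg : P.IsPolicy W g) (i : ι) :
    Continuous (P.next g i) := by
  refine (continuous_const.mul ?_).add continuous_const
  exact (hg.continuousOn hW).comp_continuous (by fun_prop) fun _ => mem_Ici.2 (le_max_left _ _)

lemma IsPolicy.exists_crossing (hW : P.IsValue W) (hg : P.IsPolicy W g) :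
    ∃ N : ℕ, (P.next g P.lo)^[N] P.top ≤ (P.next g P.hi)^[N] P.l := by
  have hlt := P.l_lt_top
  have hlo := hg.next_mem_Icc P.lo_mem
  have hhi := hg.next_mem_Icc P.hi_mem
  have mlo := hg.next_monotone hW P.lo
  have mhi := hg.next_monotone hW P.hi
  obtain ⟨z, hz1, hz2, hz3, hz4⟩ := mlo.tendsto_iterate_of_map_le (hg.next_continuous hW P.lo)
    (fun a => (hlo a).1) hlt.le (hlo P.top).2
  obtain ⟨y, hy1, hy2, hy3, hy4⟩ := mhi.tendsto_iterate_of_le_map (hg.next_continuous hW P.hi)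
    (fun a => (hhi a).2) hlt.le (hhi P.l).1
  suffices z < y from
    (hz4.eventually_lt hy4 this).exists.imp fun N h => h.le
  have hzm : z ∈ Icc P.l P.top := ⟨hz1, hz2⟩
  have hym : y ∈ Icc P.l P.top := ⟨hy1, hy2⟩
  rw [next_of_mem hzm] at hz3
  rw [next_of_mem hym] at hy3
  rcases le_or_gt (P.β * P.R) 1 with h | h
  · rw [hg.low_fixed hW h hzm hz3]
    have := mul_le_mul_of_nonneg_left (mem_feasible.1 (hg y hy1).1).1 P.R_pos.le
    linarith [P.l_fixed, P.lo_lt_hi]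
  · rw [hg.high_fixed hW h hym hy3]
    have := mul_le_mul_of_nonneg_left (mem_feasible.1 (hg z hz1).1).2.2 P.R_pos.le
    unfold top
    linarith [P.lo_lt_hi]

theorem IsPolicy.existsUnique_invariant (hW : P.IsValue W) (hg : P.IsPolicy W g) :
    ∃! μ : Measure ℝ, IsProbabilityMeasure μ ∧ μ (Icc P.l P.top)ᶜ = 0 ∧
      RandomMaps.push P.s P.w (P.next g) μ = μ := by
  obtain ⟨N, hN⟩ := hg.exists_crossing hW
  exact RandomMaps.existsUnique_invariant P.w_pos P.w_sum P.l_lt_top.le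
    (fun i _ => hg.next_monotone hW i) (fun i _ => hg.next_continuous hW i)
    (fun i hi a => hg.next_mem_Icc hi a) P.lo_mem P.hi_mem hN

end SavingsProblem

/-! ### Budget sets, demand and indirect utility -/

namespace Bewley

variable {n : ℕ} {U : (Fin n → ℝ) → ℝ} {p : Fin n → ℝ} {c : ℝ}

lemma dotProduct_lt_dotProduct_of_pos (hp : ∀ i, 0 < p i) {x y : Fin n → ℝ} (h : x < y) :
    p ⬝ᵥ x < p ⬝ᵥ y := by
  obtain ⟨hle, i, hi⟩ := Pi.lt_def.1 h
  exact Finset.sum_lt_sum (fun j _ => mul_le_mul_of_nonneg_left (hle j) (hp j).le)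
    ⟨i, Finset.mem_univ i, mul_lt_mul_of_pos_left hi (hp i)⟩

lemma dotProduct_nonneg_of_pos (hp : ∀ i, 0 < p i) {x : Fin n → ℝ} (h : 0 ≤ x) : 0 ≤ p ⬝ᵥ x :=
  Finset.sum_nonneg fun j _ => mul_nonneg (hp j).le (h j)

lemma budget_apply_le (hp : ∀ i, 0 < p i) {x : Fin n → ℝ} (hx : x ∈ budget p c) (i : Fin n) :
    x i ≤ c / p i := by
  rw [le_div_iff₀ (hp i), mul_comm, ← hx.2]
  exact Finset.single_le_sum (f := fun j => p j * x j)
    (fun j _ => mul_nonneg (hp j).le (hx.1 j)) (Finset.mem_univ i)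

lemma budget_subset_Icc (hp : ∀ i, 0 < p i) : budget p c ⊆ Icc 0 (fun i => c / p i) :=
  fun _ hx => ⟨hx.1, budget_apply_le hp hx⟩

lemma continuous_dotProduct (p : Fin n → ℝ) : Continuous fun x : Fin n → ℝ => p ⬝ᵥ x := by
  unfold dotProduct
  fun_prop

lemma isCompact_budget (hp : ∀ i, 0 < p i) : IsCompact (budget p c) :=
  isCompact_Icc.of_isClosed_subset
    (isClosed_Ici.inter (isClosed_eq (continuous_dotProduct p) continuous_const))
    (budget_subset_Icc hp)

lemma add_single_mem_budget (hp : ∀ i, 0 < p i) {x : Fin n → ℝ} (hx : x ∈ budget p c) (i : Fin n)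
    {d : ℝ} (hd : 0 ≤ d) : x + Pi.single i (d / p i) ∈ budget p (c + d) := by
  have hs : (0 : Fin n → ℝ) ≤ Pi.single i (d / p i) :=
    Pi.single_nonneg.2 (div_nonneg hd (hp i).le)
  refine ⟨add_nonneg hx.1 hs, ?_⟩
  rw [dotProduct_add, hx.2, dotProduct_single, mul_div_cancel₀ _ (hp i).ne']

lemma zero_mem_budget : (0 : Fin n → ℝ) ∈ budget p 0 := ⟨le_rfl, dotProduct_zero p⟩

lemma budget_nonempty (hp : ∀ i, 0 < p i) (hn : 0 < n) (hc : 0 ≤ c) : (budget p c).Nonempty :=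
  ⟨_, by simpa using add_single_mem_budget hp zero_mem_budget ⟨0, hn⟩ hc⟩

lemma convex_mem_budget {x y : Fin n → ℝ} {c d s t : ℝ} (hx : x ∈ budget p c) (hy : y ∈ budget p d)
    (hs : 0 ≤ s) (ht : 0 ≤ t) : s • x + t • y ∈ budget p (s * c + t * d) := by
  refine ⟨add_nonneg (smul_nonneg hs hx.1) (smul_nonneg ht hy.1), ?_⟩
  rw [dotProduct_add, dotProduct_smul, dotProduct_smul, hx.2, hy.2, smul_eq_mul, smul_eq_mul]

lemma convex_budget : Convex ℝ (budget p c) := fun x hx y hy s t hs ht hst => by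
  have := convex_mem_budget hx hy hs ht
  rwa [← add_mul, hst, one_mul] at this

namespace UtilityAssumption

variable (hU : UtilityAssumption U) (hp : ∀ i, 0 < p i) (hn : 0 < n)

include hU

lemma optimalBundle_unique {x y : Fin n → ℝ} (hx : IsOptimalBundle U p c x)
    (hy : IsOptimalBundle U p c y) : x = y :=
  (hU.strictConcave.subset (fun _ h => h.1) convex_budget).eq_of_isMaxOn hx.2 hy.2 hx.1 hy.1

include hp

lemma indirectUtility_differentiableAt (hc : 0 < c) :
    DifferentiableAt ℝ (indirectUtility U p) c :=
  ((hU.indirect_contDiff p hp).differentiableOn one_ne_zero).differentiableAt (Ioi_mem_nhds hc)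

include hn

lemma existsUnique_optimalBundle (hc : 0 ≤ c) : ∃! x, IsOptimalBundle U p c x := by
  obtain ⟨x, hx, hmax⟩ := (isCompact_budget hp).exists_isMaxOn (budget_nonempty hp hn hc)
    (hU.continuous.mono fun x (hx : x ∈ budget p c) => hx.1)
  exact ⟨x, ⟨hx, hmax⟩, fun y hy => hU.optimalBundle_unique hy ⟨hx, hmax⟩⟩

lemma isOptimalBundle_demand (hc : 0 ≤ c) : IsOptimalBundle U p c (demand U c p) :=
  Classical.epsilon_spec (hU.existsUnique_optimalBundle hp hn hc).exists

lemma le_indirectUtility {x : Fin n → ℝ} (hx : 0 ≤ x) :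
    U x ≤ indirectUtility U p (p ⬝ᵥ x) :=
  (hU.isOptimalBundle_demand hp hn (dotProduct_nonneg_of_pos hp hx)).2 ⟨hx, rfl⟩

lemma le_indirectUtility' {x : Fin n → ℝ} (hx : x ∈ budget p c) : U x ≤ indirectUtility U p c := by
  have := hU.le_indirectUtility hp hn hx.1
  rwa [hx.2] at this

lemma indirectUtility_strictMonoOn : StrictMonoOn (indirectUtility U p) (Ici 0) := by
  intro c hc d hd hcd
  have h1 := (hU.isOptimalBundle_demand hp hn hc).1
  have h2 := add_single_mem_budget hp h1 ⟨0, hn⟩ (sub_nonneg.2 hcd.le)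
  rw [add_sub_cancel] at h2
  refine lt_of_lt_of_le (hU.strictMono h1.1 h2.1 ?_) (hU.le_indirectUtility' hp hn h2)
  exact lt_add_of_pos_right _ (Pi.single_pos.2 (div_pos (sub_pos.2 hcd) (hp _)))

lemma indirectUtility_strictConcaveOn : StrictConcaveOn ℝ (Ici 0) (indirectUtility U p) := by
  refine ⟨convex_Ici 0, fun c hc d hd hcd s t hs ht hst => ?_⟩
  have h1 := (hU.isOptimalBundle_demand hp hn hc).1
  have h2 := (hU.isOptimalBundle_demand hp hn hd).1
  refine lt_of_lt_of_le (hU.strictConcave.2 h1.1 h2.1 (fun h => hcd ?_) hs ht hst)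
    (hU.le_indirectUtility' hp hn (convex_mem_budget h1 h2 hs.le ht.le))
  rw [← h1.2, ← h2.2, h]

/-- Only the endpoint needs work: there the budget set shrinks to the origin, so demand tends to
zero and continuity of `U` applies. -/
lemma indirectUtility_continuousOn : ContinuousOn (indirectUtility U p) (Ici 0) := by
  intro c hc
  rcases (show 0 ≤ c from hc).eq_or_lt with rfl | hc
  · have hd0 : demand U 0 p = 0 := by
      have h := budget_subset_Icc hp (hU.isOptimalBundle_demand hp hn le_rfl).1
      refine le_antisymm (fun i => ?_) h.1
      simpa using h.2 i
    have hlim : Tendsto (fun c => demand U c p) (𝓝[Ici 0] 0) (𝓝[Ici 0] 0) := by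
      refine tendsto_nhdsWithin_iff.2 ⟨tendsto_pi_nhds.2 fun i => ?_, ?_⟩
      · have h0 : Tendsto (fun c => c / p i) (𝓝[Ici 0] 0) (𝓝 0) := by
          have : Tendsto (fun c => c / p i) (𝓝 0) (𝓝 (0 / p i)) := tendsto_id.div_const _
          rw [zero_div] at this
          exact this.mono_left nhdsWithin_le_nhds
        refine tendsto_of_tendsto_of_tendsto_of_le_of_le' tendsto_const_nhds h0 ?_ ?_
        · filter_upwards [self_mem_nhdsWithin] with c hc using
            (hU.isOptimalBundle_demand hp hn hc).1.1 i
        · filter_upwards [self_mem_nhdsWithin] with c hc using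
            budget_apply_le hp (hU.isOptimalBundle_demand hp hn hc).1 i
      · filter_upwards [self_mem_nhdsWithin] with c hc using
          (hU.isOptimalBundle_demand hp hn hc).1.1
    have := (hU.continuous 0 (mem_Ici.2 le_rfl)).tendsto.comp hlim
    rw [ContinuousWithinAt, indirectUtility, hd0]
    exact this
  · exact (hU.indirectUtility_differentiableAt hp hc).continuousAt.continuousWithinAt

/-- Nearby demands stay in a compact box. By continuity of the indirect utility every cluster point
is optimal at `c`, hence is the unique optimal bundle. -/
lemma demand_continuousOn : ContinuousOn (fun c => demand U c p) (Ici 0) := by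
  intro c hc
  have hmem : ∀ᶠ d in 𝓝[Ici 0] c, demand U d p ∈ Icc 0 (fun i => (c + 1) / p i) := by
    filter_upwards [self_mem_nhdsWithin, nhdsWithin_le_nhds (Iio_mem_nhds (lt_add_one c))]
      with d hd hdc
    have h := budget_subset_Icc hp (hU.isOptimalBundle_demand hp hn hd).1
    exact ⟨h.1, fun i => (h.2 i).trans (div_le_div_of_nonneg_right (le_of_lt hdc) (hp i).le)⟩
  refine isCompact_Icc.tendsto_nhds_of_unique_mapClusterPt hmem fun y hy hcl => ?_
  obtain ⟨F, hF, hFy⟩ := mapClusterPt_iff_ultrafilter.1 hcl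
  have hFc : Tendsto id (F : Filter ℝ) (𝓝 c) := hF.trans nhdsWithin_le_nhds
  have hopt : ∀ᶠ d in (F : Filter ℝ), demand U d p ∈ budget p d :=
    hF (eventually_nhdsWithin_of_forall fun d hd => (hU.isOptimalBundle_demand hp hn hd).1)
  have hyc : p ⬝ᵥ y = c :=
    tendsto_nhds_unique (((continuous_dotProduct p).tendsto y).comp hFy)
      (hFc.congr' (hopt.mono fun d hd => hd.2.symm))
  have hUy : U y = indirectUtility U p c := by
    refine tendsto_nhds_unique ((hU.continuous y hy.1).tendsto.comp
      (tendsto_nhdsWithin_iff.2 ⟨hFy, hopt.mono fun d hd => hd.1⟩)) ?_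
    exact (hU.indirectUtility_continuousOn hp hn c hc).tendsto.mono_left hF
  refine hU.optimalBundle_unique ⟨⟨hy.1, hyc⟩, fun x hx => ?_⟩
    (hU.isOptimalBundle_demand hp hn hc)
  exact (hU.le_indirectUtility' hp hn hx).trans hUy.ge

end UtilityAssumption

end Bewley

/-! ### Continuation values that agree on the wealth interval -/

namespace SavingsProblem

variable {ι : Type*} {P : SavingsProblem ι} {W W' g : ℝ → ℝ}

lemma objective_congr (h : EqOn W W' (Icc P.l P.top)) (a : ℝ) :
    EqOn (P.objective W a) (P.objective W' a) (P.feasible a) := by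
  intro b hb
  have : P.expect W b = P.expect W' b :=
    Finset.sum_congr rfl fun i hi => by rw [h (P.next_mem (feasible_subset hb) hi)]
  rw [objective, objective, this]

lemma IsValue.congr (hW : P.IsValue W) (h : EqOn W W' (Icc P.l P.top)) : P.IsValue W' := by
  refine ⟨hW.cont.congr h.symm, hW.conc.congr h, fun a ha => ?_⟩
  rw [← h ha, ← (objective_congr h a).image_eq]
  exact hW.bellman a ha

lemma IsValue.exists_isPolicy (hW : P.IsValue W) : ∃ g, P.IsPolicy W g := by
  choose! g hg using fun a (ha : P.l ≤ a) => (hW.existsUnique_max ha).exists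
  exact ⟨g, hg⟩

end SavingsProblem

/-! ### The economy as a savings problem -/

namespace Bewley

namespace Economy

variable {n : ℕ} (E : Economy n) {p : Fin n → ℝ} {r : ℝ}

include E in
lemma n_pos : 0 < n := two_pos.trans_le E.two_le

lemma minIncome_pos (hp : ∀ i, 0 < p i) : 0 < E.minIncome p := by
  refine (Finset.lt_inf'_iff _).2 fun y hy => ?_
  have : (0 : Fin n → ℝ) < y :=
    Pi.lt_def.2 ⟨fun i => (E.Y_pos y hy i).le, ⟨0, E.n_pos⟩, E.Y_pos y hy _⟩
  simpa using dotProduct_lt_dotProduct_of_pos hp this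

/-- An endowment vector of minimal value. -/
def worst (p : Fin n → ℝ) : Fin n → ℝ :=
  (E.Y.exists_mem_eq_inf' E.nontrivial.nonempty fun y => p ⬝ᵥ y).choose

lemma worst_mem (p : Fin n → ℝ) : E.worst p ∈ E.Y :=
  (E.Y.exists_mem_eq_inf' E.nontrivial.nonempty fun y => p ⬝ᵥ y).choose_spec.1

lemma dotProduct_worst (p : Fin n → ℝ) : p ⬝ᵥ E.worst p = E.minIncome p :=
  (E.Y.exists_mem_eq_inf' E.nontrivial.nonempty fun y => p ⬝ᵥ y).choose_spec.2.symm

/-- The largest endowment vector. -/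
def best : Fin n → ℝ := E.exists_top.choose

lemma best_mem : E.best ∈ E.Y := E.exists_top.choose_spec.1

lemma le_best {y : Fin n → ℝ} (hy : y ∈ E.Y) : y ≤ E.best := E.exists_top.choose_spec.2 y hy

lemma dotProduct_le_best (hp : ∀ i, 0 < p i) {y : Fin n → ℝ} (hy : y ∈ E.Y) :
    p ⬝ᵥ y ≤ p ⬝ᵥ E.best :=
  Finset.sum_le_sum fun i _ => mul_le_mul_of_nonneg_left (E.le_best hy i) (hp i).le

lemma dotProduct_best (hp : ∀ i, 0 < p i) : p ⬝ᵥ E.best = E.maxIncome p :=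
  le_antisymm (Finset.le_sup' (fun y => p ⬝ᵥ y) E.best_mem)
    (Finset.sup'_le _ _ fun _ hy => E.dotProduct_le_best hp hy)

lemma minIncome_le {y : Fin n → ℝ} (hy : y ∈ E.Y) : E.minIncome p ≤ p ⬝ᵥ y :=
  Finset.inf'_le (fun y => p ⬝ᵥ y) hy

lemma worst_lt_best (hp : ∀ i, 0 < p i) : p ⬝ᵥ E.worst p < p ⬝ᵥ E.best := by
  obtain ⟨y, hy, hne⟩ := E.nontrivial.exists_ne E.best
  rw [dotProduct_worst]
  exact (E.minIncome_le hy).trans_lt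
    (dotProduct_lt_dotProduct_of_pos hp (lt_of_le_of_ne (E.le_best hy) hne))

/-- The savings problem of an agent who at every expenditure demands an optimal bundle. -/
def savingsProblem (hp : ∀ i, 0 < p i) (hr : 0 < r) : SavingsProblem (Fin n → ℝ) where
  s := E.Y
  w := E.e
  q y := p ⬝ᵥ y
  u := indirectUtility E.U p
  β := E.β
  R := 1 + r
  l := E.borrowLimit p r
  B := E.savingsBound p r
  lo := E.worst p
  hi := E.best
  w_pos := E.e_pos
  w_sum := E.e_sum
  lo_mem := E.worst_mem p
  hi_mem := E.best_mem
  q_lo y hy := E.dotProduct_worst p ▸ E.minIncome_le hy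
  q_hi _ hy := E.dotProduct_le_best hp hy
  lo_lt_hi := E.worst_lt_best hp
  β_pos := by linarith [E.half_lt_β]
  β_lt_one := E.β_lt_one
  one_lt_R := by linarith
  l_lt_B := by
    have h1 : E.borrowLimit p r < 0 := neg_lt_zero.2 (div_pos (E.minIncome_pos hp) hr)
    have h2 : 0 ≤ E.savingsBound p r := div_nonneg
      (mul_nonneg (Finset.sum_nonneg fun i _ => (hp i).le) E.bbar_pos.le) (sq_nonneg _)
    exact h1.trans_le h2
  l_fixed := by
    rw [dotProduct_worst, borrowLimit]
    field_simp
    ring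
  u_mono := E.utility.indirectUtility_strictMonoOn hp E.n_pos
  u_cont := E.utility.indirectUtility_continuousOn hp E.n_pos
  u_conc := E.utility.indirectUtility_strictConcaveOn hp E.n_pos
  u_diff _ hc := E.utility.indirectUtility_differentiableAt hp hc
  u_steep := E.utility.indirect_zero p hp

variable (hp : ∀ i, 0 < p i) (hr : 0 < r)

lemma minWealth_eq : E.minWealth p r = (E.savingsProblem hp hr).l := by
  rw [minWealth, ← dotProduct_worst]
  exact (E.savingsProblem hp hr).l_fixed

lemma maxWealth_eq : E.maxWealth p r = (E.savingsProblem hp hr).top := by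
  rw [maxWealth, ← E.dotProduct_best hp]
  rfl

lemma wealthSet_eq : E.wealthSet p r =
    Icc (E.savingsProblem hp hr).l (E.savingsProblem hp hr).top := by
  rw [wealthSet, E.minWealth_eq hp hr, E.maxWealth_eq hp hr]

/-! ### The value function solves the Bellman equation -/

/-- The expected utility of the first `T` periods. -/
def partialValue (p : Fin n → ℝ) (r : ℝ) (π : List ℝ → ℝ → (Fin n → ℝ)) (T : ℕ) (past : List ℝ)
    (a : ℝ) : ℝ :=
  ∑ t ∈ Finset.range T, E.β ^ t * E.expectedUtility p r π t past a

lemma partialValue_succ (π : List ℝ → ℝ → (Fin n → ℝ)) (T : ℕ) (past : List ℝ) (a : ℝ) :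
    E.partialValue p r π (T + 1) past a = E.U (π past a) + E.β * ∑ y ∈ E.Y, E.e y *
      E.partialValue p r π T (past ++ [a]) ((1 + r) * (a - p ⬝ᵥ π past a) + p ⬝ᵥ y) := by
  simp only [partialValue, Finset.sum_range_succ', expectedUtility, pow_zero, one_mul,
    Finset.mul_sum]
  rw [add_comm, Finset.sum_comm]
  congr 1
  refine Finset.sum_congr rfl fun y _ => Finset.sum_congr rfl fun t _ => ?_
  rw [pow_succ]
  ring

variable {E} {π : List ℝ → ℝ → (Fin n → ℝ)}

include hp hr in
lemma IsStrategy.next_mem (hπ : E.IsStrategy p r π) {past : List ℝ} {a : ℝ}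
    (hpast : ∀ w ∈ past, w ∈ E.wealthSet p r) (ha : a ∈ E.wealthSet p r) {y : Fin n → ℝ}
    (hy : y ∈ E.Y) : (∀ w ∈ past ++ [a], w ∈ E.wealthSet p r) ∧
      (1 + r) * (a - p ⬝ᵥ π past a) + p ⬝ᵥ y ∈ E.wealthSet p r := by
  refine ⟨fun w hw => ?_, ?_⟩
  · rcases List.mem_append.1 hw with h | h
    · exact hpast w h
    · rw [List.mem_singleton.1 h]; exact ha
  · rw [E.wealthSet_eq hp hr]
    exact (E.savingsProblem hp hr).next_mem
      (SavingsProblem.feasible_subset (P := E.savingsProblem hp hr) (hπ past a hpast ha).2) hy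

/-- Iterating the Bellman inequality bounds `T` periods of utility plus the discounted value of
final wealth by `W a`; final wealth is worth at least `W` at the minimum. -/
lemma IsStrategy.partialValue_le {W : ℝ → ℝ} (hW : (E.savingsProblem hp hr).IsValue W)
    (hπ : E.IsStrategy p r π) (T : ℕ) : ∀ (past : List ℝ) (a : ℝ),
    (∀ w ∈ past, w ∈ E.wealthSet p r) → a ∈ E.wealthSet p r →
    E.partialValue p r π T past a ≤ W a - E.β ^ T * W (E.minWealth p r) := by
  have hβ := (E.savingsProblem hp hr).β_pos
  change 0 < E.β at hβ
  induction T with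
  | zero =>
    intro past a _ ha
    rw [E.wealthSet_eq hp hr] at ha
    have := hW.mono ⟨le_rfl, (E.savingsProblem hp hr).l_lt_top.le⟩ ha ha.1
    rw [← E.minWealth_eq hp hr] at this
    simpa [partialValue] using this
  | succ T ih =>
    intro past a hpast ha
    obtain ⟨h0, hf⟩ := hπ past a hpast ha
    set x := π past a with hx
    have h1 := (hW.bellman a (E.wealthSet_eq hp hr ▸ ha)).2 (mem_image_of_mem _ hf)
    have h2 := E.utility.le_indirectUtility hp E.n_pos h0
    have h3 : ∑ y ∈ E.Y, E.e y * E.partialValue p r π T (past ++ [a])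
        ((1 + r) * (a - p ⬝ᵥ x) + p ⬝ᵥ y) ≤ ∑ y ∈ E.Y, E.e y *
        (W ((1 + r) * (a - p ⬝ᵥ x) + p ⬝ᵥ y) - E.β ^ T * W (E.minWealth p r)) :=
      Finset.sum_le_sum fun y hy => by
        obtain ⟨k1, k2⟩ := hπ.next_mem hp hr hpast ha hy
        exact mul_le_mul_of_nonneg_left (ih _ _ k1 k2) (E.e_pos y hy).le
    simp only [mul_sub, Finset.sum_sub_distrib] at h3
    rw [← Finset.sum_mul, E.e_sum, one_mul] at h3
    have h4 := mul_le_mul_of_nonneg_left h3 hβ.le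
    rw [E.partialValue_succ, ← hx]
    change indirectUtility E.U p (a - (a - p ⬝ᵥ x)) + E.β * ∑ y ∈ E.Y, E.e y *
      W ((1 + r) * (a - p ⬝ᵥ x) + p ⬝ᵥ y) ≤ W a at h1
    rw [sub_sub_cancel] at h1
    simp only [mul_sub] at h1 h4 ⊢
    rw [pow_succ]
    linarith

/-- The stationary strategy that follows a savings policy. -/
def policyStrategy (E : Economy n) (p : Fin n → ℝ) (g : ℝ → ℝ) : List ℝ → ℝ → (Fin n → ℝ) :=
  fun _ a => demand E.U (a - g a) p

lemma dotProduct_policyStrategy {W g : ℝ → ℝ} (hg : (E.savingsProblem hp hr).IsPolicy W g)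
    {past : List ℝ} {a : ℝ} (ha : a ∈ E.wealthSet p r) :
    0 ≤ E.policyStrategy p g past a ∧ p ⬝ᵥ E.policyStrategy p g past a = a - g a := by
  rw [E.wealthSet_eq hp hr] at ha
  exact (E.utility.isOptimalBundle_demand hp E.n_pos
    (sub_nonneg.2 (SavingsProblem.mem_feasible.1 (hg a ha.1).1).2.1)).1

lemma isStrategy_policyStrategy {W g : ℝ → ℝ} (hg : (E.savingsProblem hp hr).IsPolicy W g) :
    E.IsStrategy p r (E.policyStrategy p g) := by
  intro past a _ ha
  obtain ⟨h1, h2⟩ := dotProduct_policyStrategy hp hr hg (past := past) ha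
  rw [E.wealthSet_eq hp hr] at ha
  rw [h2, sub_sub_cancel]
  exact ⟨h1, (hg a ha.1).1⟩

/-- Along the optimal policy the Bellman inequality is an equality, and final wealth is worth at
most `W` at the maximum. -/
lemma le_partialValue_policyStrategy {W g : ℝ → ℝ} (hW : (E.savingsProblem hp hr).IsValue W)
    (hg : (E.savingsProblem hp hr).IsPolicy W g) (T : ℕ) : ∀ (past : List ℝ) (a : ℝ),
    (∀ w ∈ past, w ∈ E.wealthSet p r) → a ∈ E.wealthSet p r →
    W a - E.β ^ T * W (E.maxWealth p r) ≤ E.partialValue p r (E.policyStrategy p g) T past a := by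
  have hβ := (E.savingsProblem hp hr).β_pos
  change 0 < E.β at hβ
  have hπ := isStrategy_policyStrategy hp hr hg
  induction T with
  | zero =>
    intro past a _ ha
    rw [E.wealthSet_eq hp hr] at ha
    have := hW.mono ha ⟨(E.savingsProblem hp hr).l_lt_top.le, le_rfl⟩ ha.2
    rw [← E.maxWealth_eq hp hr] at this
    simpa [partialValue] using this
  | succ T ih =>
    intro past a hpast ha
    obtain ⟨-, hx⟩ := dotProduct_policyStrategy hp hr hg (past := past) ha
    have h1 := hg.value_eq hW (E.wealthSet_eq hp hr ▸ ha)
    have h3 : ∑ y ∈ E.Y, E.e y * (W ((1 + r) * g a + p ⬝ᵥ y) - E.β ^ T * W (E.maxWealth p r)) ≤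
        ∑ y ∈ E.Y, E.e y * E.partialValue p r (E.policyStrategy p g) T (past ++ [a])
          ((1 + r) * g a + p ⬝ᵥ y) :=
      Finset.sum_le_sum fun y hy => by
        obtain ⟨k1, k2⟩ := hπ.next_mem hp hr hpast ha hy
        rw [hx, sub_sub_cancel] at k2
        exact mul_le_mul_of_nonneg_left (ih _ _ k1 k2) (E.e_pos y hy).le
    simp only [mul_sub, Finset.sum_sub_distrib] at h3
    rw [← Finset.sum_mul, E.e_sum, one_mul] at h3
    have h4 := mul_le_mul_of_nonneg_left h3 hβ.le
    rw [E.partialValue_succ, hx, sub_sub_cancel]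
    change W a = indirectUtility E.U p (a - g a) + E.β * ∑ y ∈ E.Y, E.e y *
      W ((1 + r) * g a + p ⬝ᵥ y) at h1
    change _ ≤ indirectUtility E.U p (a - g a) + _
    rw [pow_succ]
    linarith

include hp hr in
lemma IsStrategy.expectedUtility_mem (hπ : E.IsStrategy p r π) (t : ℕ) :
    ∀ (past : List ℝ) (a : ℝ), (∀ w ∈ past, w ∈ E.wealthSet p r) → a ∈ E.wealthSet p r →
    E.expectedUtility p r π t past a ∈
      Icc (E.U 0) (indirectUtility E.U p (E.maxWealth p r - E.minWealth p r)) := by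
  induction t with
  | zero =>
    intro past a hpast ha
    obtain ⟨h0, hf⟩ := hπ past a hpast ha
    rw [expectedUtility]
    refine ⟨E.utility.strictMono.monotoneOn (mem_Ici.2 le_rfl) h0 h0,
      (E.utility.le_indirectUtility hp E.n_pos h0).trans ?_⟩
    have h1 := dotProduct_nonneg_of_pos hp h0
    have h2 : p ⬝ᵥ π past a ≤ E.maxWealth p r - E.minWealth p r := by
      have h3 : E.minWealth p r ≤ a - p ⬝ᵥ π past a := by
        rw [E.minWealth_eq hp hr]; exact hf.1
      linarith [ha.2]
    exact (E.utility.indirectUtility_strictMonoOn hp E.n_pos).monotoneOn h1 (h1.trans h2) h2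
  | succ t ih =>
    intro past a hpast ha
    have hmem : ∀ y ∈ E.Y, _ := fun y hy =>
      ih _ _ (hπ.next_mem hp hr hpast ha hy).1 (hπ.next_mem hp hr hpast ha hy).2
    have := (convex_Icc (E.U 0)
      (indirectUtility E.U p (E.maxWealth p r - E.minWealth p r))).sum_mem
      (fun y hy => (E.e_pos y hy).le) E.e_sum hmem
    simpa only [smul_eq_mul, expectedUtility] using this

include hp hr in
lemma IsStrategy.tendsto_partialValue (hπ : E.IsStrategy p r π) {a : ℝ}
    (ha : a ∈ E.wealthSet p r) :
    Tendsto (fun T => E.partialValue p r π T [] a) atTop (𝓝 (E.strategyValue p r π a)) := by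
  have hβ := (E.savingsProblem hp hr).β_pos
  change 0 < E.β at hβ
  have hsum : Summable fun t : ℕ => E.β ^ t * E.expectedUtility p r π t [] a := by
    refine Summable.of_norm_bounded
      ((summable_geometric_of_lt_one hβ.le E.β_lt_one).mul_right (max |E.U 0|
        |indirectUtility E.U p (E.maxWealth p r - E.minWealth p r)|)) fun t => ?_
    obtain ⟨h1, h2⟩ := hπ.expectedUtility_mem hp hr t [] a (by simp) ha
    rw [Real.norm_eq_abs, abs_mul, abs_of_pos (pow_pos hβ t)]
    exact mul_le_mul_of_nonneg_left (abs_le_max_abs_abs h1 h2) (pow_pos hβ t).le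
  exact hsum.hasSum.tendsto_sum_nat

lemma tendsto_sub_pow_mul (E : Economy n) (v c : ℝ) :
    Tendsto (fun T : ℕ => v - E.β ^ T * c) atTop (𝓝 v) := by
  have := ((tendsto_pow_atTop_nhds_zero_of_lt_one (by linarith [E.half_lt_β])
    E.β_lt_one).mul_const c).const_sub v
  rwa [zero_mul, sub_zero] at this

/-- The value function is the solution of the Bellman equation. -/
lemma value_eq {W : ℝ → ℝ} (hW : (E.savingsProblem hp hr).IsValue W) {a : ℝ}
    (ha : a ∈ E.wealthSet p r) : E.value p r a = W a := by
  obtain ⟨g, hg⟩ := hW.exists_isPolicy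
  have hle : ∀ π, E.IsStrategy p r π → E.strategyValue p r π a ≤ W a := fun π hπ =>
    le_of_tendsto_of_tendsto' (hπ.tendsto_partialValue hp hr ha) (E.tendsto_sub_pow_mul _ _)
      fun T => hπ.partialValue_le hp hr hW T [] a (by simp) ha
  have hπ := isStrategy_policyStrategy hp hr hg
  have hge : W a ≤ E.strategyValue p r (E.policyStrategy p g) a :=
    le_of_tendsto_of_tendsto' (E.tendsto_sub_pow_mul _ _) (hπ.tendsto_partialValue hp hr ha)
      fun T => le_partialValue_policyStrategy hp hr hW hg T [] a (by simp) ha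
  refine IsGreatest.csSup_eq ⟨⟨_, hπ, le_antisymm hge (hle _ hπ)⟩, ?_⟩
  rintro _ ⟨π, hπ, rfl⟩
  exact hle π hπ

lemma isValue_value : (E.savingsProblem hp hr).IsValue (E.value p r) := by
  obtain ⟨W, hW⟩ := (E.savingsProblem hp hr).exists_isValue
  exact hW.congr fun a ha => (value_eq hp hr hW (E.wealthSet_eq hp hr ▸ ha)).symm

/-! ### Optimal savings, the invariant distribution and well-posedness -/

include hp hr in
lemma existsUnique_isOptimalSavings {a : ℝ} (ha : E.minWealth p r ≤ a) :
    ∃! b, E.IsOptimalSavings p r a b := by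
  rw [E.minWealth_eq hp hr] at ha
  exact (isValue_value hp hr).existsUnique_max ha

include hp hr in
lemma isOptimalSavings_savings {a : ℝ} (ha : E.minWealth p r ≤ a) :
    E.IsOptimalSavings p r a (E.savings a p r) :=
  Classical.epsilon_spec (existsUnique_isOptimalSavings hp hr ha).exists

lemma isPolicy_savings :
    (E.savingsProblem hp hr).IsPolicy (E.value p r) (fun a => E.savings a p r) := fun _ ha =>
  isOptimalSavings_savings hp hr (E.minWealth_eq hp hr ▸ ha)

/-- The clamped maps `next` agree with the law of motion on the wealth set, which carries all mass,
so both forms of invariance coincide. -/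
lemma isInvariant_iff {W g : ℝ → ℝ} (hW : (E.savingsProblem hp hr).IsValue W)
    (hg : (E.savingsProblem hp hr).IsPolicy W g) (μ : Measure ℝ) :
    E.IsInvariant p r g μ ↔ IsProbabilityMeasure μ ∧
      μ (Icc (E.savingsProblem hp hr).l (E.savingsProblem hp hr).top)ᶜ = 0 ∧
      RandomMaps.push E.Y E.e ((E.savingsProblem hp hr).next g) μ = μ := by
  set P := E.savingsProblem hp hr
  have hA : MeasurableSet (E.wealthSet p r) := measurableSet_Icc
  have hc : ∀ y ∈ E.Y, Continuous (P.next g y) := fun y _ => hg.next_continuous hW y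
  rw [← E.wealthSet_eq hp hr]
  have key : μ (E.wealthSet p r)ᶜ = 0 → ∀ D, MeasurableSet D →
      ∫⁻ a in E.wealthSet p r, ∑ y ∈ E.Y,
        ENNReal.ofReal (E.e y) * D.indicator 1 ((1 + r) * g a + p ⬝ᵥ y) ∂μ =
      RandomMaps.push E.Y E.e (P.next g) μ D := by
    intro h0 D hD
    have hm : ∀ y ∈ E.Y, Measurable fun a => D.indicator (1 : ℝ → ENNReal) (P.next g y a) :=
      fun y hy => (measurable_one.indicator hD).comp (hc y hy).measurable
    calc _ = ∫⁻ a in E.wealthSet p r, ∑ y ∈ E.Y,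
          ENNReal.ofReal (E.e y) * D.indicator 1 (P.next g y a) ∂μ := by
          refine setLIntegral_congr_fun hA fun a ha => ?_
          rw [E.wealthSet_eq hp hr] at ha
          refine Finset.sum_congr rfl fun y _ => ?_
          rw [SavingsProblem.next_of_mem ha]
          rfl
      _ = ∫⁻ a, ∑ y ∈ E.Y, ENNReal.ofReal (E.e y) * D.indicator 1 (P.next g y a) ∂μ := by
          rw [Measure.restrict_eq_self_of_ae_mem (show ∀ᵐ a ∂μ, a ∈ E.wealthSet p r from h0)]
      _ = _ := by
          rw [lintegral_finsetSum' _ fun y hy => ((hm y hy).const_mul _).aemeasurable,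
            RandomMaps.push_apply hc μ hD]
          refine Finset.sum_congr rfl fun y hy => ?_
          rw [lintegral_const_mul _ (hm y hy)]
          congr 1
          exact lintegral_indicator_one (hD.preimage (hc y hy).measurable)
  constructor
  · rintro ⟨h1, h2, h3⟩
    refine ⟨h1, h2, Measure.ext fun D hD => ?_⟩
    have hpush0 : RandomMaps.push E.Y E.e (P.next g) μ (E.wealthSet p r)ᶜ = 0 := by
      rw [E.wealthSet_eq hp hr]
      exact RandomMaps.push_compl_Icc (fun y hy a => hg.next_mem_Icc hy a) hc μ
    have hsplit : ∀ ν : Measure ℝ, ν (E.wealthSet p r)ᶜ = 0 → ν D = ν (D ∩ E.wealthSet p r) :=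
      fun ν hν => (measure_inter_conull hν).symm
    rw [hsplit _ hpush0, hsplit _ h2, h3 _ (hD.inter hA) inter_subset_right,
      key h2 _ (hD.inter hA)]
  · rintro ⟨h1, h2, h3⟩
    exact ⟨h1, h2, fun D hD _ => by rw [key h2 D hD, h3]⟩

include hp hr in
lemma existsUnique_isInvariant : ∃! μ, E.IsInvariant p r (fun a => E.savings a p r) μ := by
  have hW := isValue_value (E := E) hp hr
  have hg := isPolicy_savings (E := E) hp hr
  obtain ⟨μ, h1, h2⟩ := hg.existsUnique_invariant hW
  exact ⟨μ, (isInvariant_iff hp hr hW hg μ).2 h1, fun ν hν =>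
    h2 ν ((isInvariant_iff hp hr hW hg ν).1 hν)⟩

include hp hr in
lemma isInvariant_invariantDist :
    E.IsInvariant p r (fun a => E.savings a p r) (E.invariantDist p r) :=
  Classical.epsilon_spec (existsUnique_isInvariant hp hr).exists

include hp hr in
lemma savings_continuousOn : ContinuousOn (fun a => E.savings a p r) (E.wealthSet p r) := by
  rw [E.wealthSet_eq hp hr]
  exact ((isPolicy_savings hp hr).continuousOn (isValue_value hp hr)).mono Icc_subset_Ici_self

include hp hr in
theorem wellPosed : E.WellPosed p r := by
  have := (isInvariant_invariantDist (E := E) hp hr).prob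
  have hS := savings_continuousOn (E := E) hp hr
  refine ⟨fun c hc => E.utility.existsUnique_optimalBundle hp E.n_pos hc,
    fun a ha => existsUnique_isOptimalSavings hp hr ha, existsUnique_isInvariant hp hr,
    hS.integrableOn_compact isCompact_Icc, fun i => ?_⟩
  refine ContinuousOn.integrableOn_compact isCompact_Icc ?_
  refine (continuous_apply i).comp_continuousOn ?_
  refine (E.utility.demand_continuousOn hp E.n_pos).comp (continuousOn_id.sub hS) fun a ha => ?_
  exact sub_nonneg.2 (SavingsProblem.mem_feasible.1
    (isPolicy_savings (E := E) hp hr a (E.minWealth_eq hp hr ▸ ha.1)).1).2.1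

end Economy

end Bewley

/-! ### Homogeneity in prices -/

namespace Bewley

variable {n : ℕ} {U : (Fin n → ℝ) → ℝ} {p : Fin n → ℝ} {θ : ℝ}

lemma budget_smul (hθ : 0 < θ) (c : ℝ) : budget (θ • p) (θ * c) = budget p c := by
  ext x
  simp only [budget, mem_ofPred_eq, smul_dotProduct, smul_eq_mul, mul_right_inj' hθ.ne']

/-- As an equality of predicates this rewrites under `Classical.epsilon`, so `demand_smul` needs no
existence or uniqueness. -/
lemma isOptimalBundle_smul (hθ : 0 < θ) (c : ℝ) :
    IsOptimalBundle U (θ • p) (θ * c) = IsOptimalBundle U p c := by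
  funext x
  rw [IsOptimalBundle, IsOptimalBundle, budget_smul hθ]

lemma demand_smul (hθ : 0 < θ) (c : ℝ) : demand U (θ * c) (θ • p) = demand U c p := by
  rw [demand, demand, isOptimalBundle_smul hθ]

namespace Economy

variable (E : Economy n) {r : ℝ}

lemma minIncome_smul (hθ : 0 < θ) : E.minIncome (θ • p) = θ * E.minIncome p := by
  rw [minIncome, minIncome, Finset.apply_inf'_eq_inf'_comp _ (θ * ·)
    fun _ _ => mul_min_of_nonneg _ _ hθ.le]
  simp only [smul_dotProduct, smul_eq_mul]
  rfl

lemma maxIncome_smul (hθ : 0 < θ) : E.maxIncome (θ • p) = θ * E.maxIncome p := by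
  rw [maxIncome, maxIncome, Finset.apply_sup'_eq_sup'_comp _ (θ * ·)
    fun _ _ => mul_max_of_nonneg _ _ hθ.le]
  simp only [smul_dotProduct, smul_eq_mul]
  rfl

lemma borrowLimit_smul (hθ : 0 < θ) : E.borrowLimit (θ • p) r = θ * E.borrowLimit p r := by
  rw [borrowLimit, borrowLimit, E.minIncome_smul hθ]
  ring

lemma savingsBound_smul : E.savingsBound (θ • p) r = θ * E.savingsBound p r := by
  simp only [savingsBound, Pi.smul_apply, smul_eq_mul, ← Finset.mul_sum]
  ring

lemma minWealth_smul (hθ : 0 < θ) : E.minWealth (θ • p) r = θ * E.minWealth p r := by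
  rw [minWealth, minWealth, E.borrowLimit_smul hθ, E.minIncome_smul hθ]
  ring

lemma maxWealth_smul (hθ : 0 < θ) : E.maxWealth (θ • p) r = θ * E.maxWealth p r := by
  rw [maxWealth, maxWealth, E.savingsBound_smul, E.maxIncome_smul hθ]
  ring

variable {E}

lemma mul_mem_feasibleSavings (hθ : 0 < θ) {a b : ℝ} :
    θ * b ∈ E.feasibleSavings (θ • p) r (θ * a) ↔ b ∈ E.feasibleSavings p r a := by
  simp only [feasibleSavings, mem_Icc, E.borrowLimit_smul hθ, E.savingsBound_smul,
    ← mul_min_of_nonneg _ _ hθ.le, mul_le_mul_iff_right₀ hθ]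

lemma mul_mem_wealthSet (hθ : 0 < θ) {a : ℝ} :
    θ * a ∈ E.wealthSet (θ • p) r ↔ a ∈ E.wealthSet p r := by
  simp only [wealthSet, mem_Icc, E.minWealth_smul hθ, E.maxWealth_smul hθ,
    mul_le_mul_iff_right₀ hθ]

lemma inv_mul_mem_wealthSet (hθ : 0 < θ) {a : ℝ} :
    θ⁻¹ * a ∈ E.wealthSet p r ↔ a ∈ E.wealthSet (θ • p) r := by
  rw [← mul_mem_wealthSet hθ, mul_inv_cancel_left₀ hθ.ne']

/-- The strategy `π` with all wealth levels divided by `θ`. -/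
def rescale (θ : ℝ) (π : List ℝ → ℝ → (Fin n → ℝ)) : List ℝ → ℝ → (Fin n → ℝ) :=
  fun past a => π (past.map (θ⁻¹ * ·)) (θ⁻¹ * a)

lemma IsStrategy.rescale (hθ : 0 < θ) {π : List ℝ → ℝ → (Fin n → ℝ)} (hπ : E.IsStrategy p r π) :
    E.IsStrategy (θ • p) r (rescale θ π) := by
  intro past a hpast ha
  obtain ⟨h1, h2⟩ := hπ (past.map (θ⁻¹ * ·)) (θ⁻¹ * a) (by
    intro w hw
    obtain ⟨v, hv, rfl⟩ := List.mem_map.1 hw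
    exact (inv_mul_mem_wealthSet hθ).2 (hpast v hv)) ((inv_mul_mem_wealthSet hθ).2 ha)
  refine ⟨h1, ?_⟩
  rw [← mul_mem_feasibleSavings hθ, mul_sub, mul_inv_cancel_left₀ hθ.ne'] at h2
  rwa [smul_dotProduct, smul_eq_mul]

lemma expectedUtility_rescale (hθ : 0 < θ) (π : List ℝ → ℝ → (Fin n → ℝ)) (t : ℕ) :
    ∀ (past : List ℝ) (a : ℝ), E.expectedUtility (θ • p) r (rescale θ π) t past a =
      E.expectedUtility p r π t (past.map (θ⁻¹ * ·)) (θ⁻¹ * a) := by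
  induction t with
  | zero => intro past a; rfl
  | succ t ih =>
    intro past a
    simp only [expectedUtility, ih, List.map_append, List.map_cons, List.map_nil]
    refine Finset.sum_congr rfl fun y _ => ?_
    congr 2
    simp only [rescale, smul_dotProduct, smul_eq_mul]
    field_simp

lemma strategyValue_rescale (hθ : 0 < θ) (π : List ℝ → ℝ → (Fin n → ℝ)) (a : ℝ) :
    E.strategyValue (θ • p) r (rescale θ π) (θ * a) = E.strategyValue p r π a := by
  simp only [strategyValue, expectedUtility_rescale hθ, List.map_nil, inv_mul_cancel_left₀ hθ.ne']

lemma strategyValues_subset (hθ : 0 < θ) (p : Fin n → ℝ) (a : ℝ) :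
    {v | ∃ π, E.IsStrategy p r π ∧ v = E.strategyValue p r π a} ⊆
      {v | ∃ π, E.IsStrategy (θ • p) r π ∧ v = E.strategyValue (θ • p) r π (θ * a)} := by
  rintro _ ⟨π, hπ, rfl⟩
  exact ⟨rescale θ π, hπ.rescale hθ, (strategyValue_rescale hθ π a).symm⟩

lemma value_smul (hθ : 0 < θ) (a : ℝ) : E.value (θ • p) r (θ * a) = E.value p r a := by
  refine congrArg sSup (Subset.antisymm ?_ (strategyValues_subset hθ p a))
  -- Rescaling by the inverse factor gives the reverse inclusion; equality of the two sets makes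
  -- boundedness irrelevant.
  have := strategyValues_subset (E := E) (r := r) (inv_pos.2 hθ) (θ • p) (θ * a)
  rwa [inv_smul_smul₀ hθ.ne', inv_mul_cancel_left₀ hθ.ne'] at this

lemma savingsObjective_smul (hθ : 0 < θ) (a b : ℝ) :
    E.savingsObjective (θ • p) r (θ * a) (θ * b) = E.savingsObjective p r a b := by
  rw [savingsObjective, savingsObjective, ← mul_sub, demand_smul hθ]
  congr 2
  refine Finset.sum_congr rfl fun y _ => ?_
  rw [← value_smul hθ ((1 + r) * b + p ⬝ᵥ y), smul_dotProduct, smul_eq_mul]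
  congr 2
  ring

lemma IsOptimalSavings.smul (hθ : 0 < θ) {a b : ℝ} (h : E.IsOptimalSavings p r a b) :
    E.IsOptimalSavings (θ • p) r (θ * a) (θ * b) := by
  refine ⟨(mul_mem_feasibleSavings hθ).2 h.1, fun b' hb' => ?_⟩
  rw [← mul_inv_cancel_left₀ hθ.ne' b'] at hb' ⊢
  show E.savingsObjective (θ • p) r (θ * a) _ ≤ E.savingsObjective (θ • p) r (θ * a) _
  rw [savingsObjective_smul hθ, savingsObjective_smul hθ]
  exact h.2 ((mul_mem_feasibleSavings hθ).1 hb')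

lemma smul_pos (hθ : 0 < θ) (hp : ∀ i, 0 < p i) (i : Fin n) : 0 < (θ • p) i :=
  mul_pos hθ (hp i)

/-- The scaled optimum is an optimum of the scaled problem; uniqueness makes it the chosen one. -/
lemma savings_smul (hθ : 0 < θ) (hp : ∀ i, 0 < p i) (hr : 0 < r) {a : ℝ}
    (ha : E.minWealth p r ≤ a) : E.savings (θ * a) (θ • p) r = θ * E.savings a p r := by
  have ha' : E.minWealth (θ • p) r ≤ θ * a := by
    rw [E.minWealth_smul hθ]; exact mul_le_mul_of_nonneg_left ha hθ.le
  exact (existsUnique_isOptimalSavings (smul_pos hθ hp) hr ha').unique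
    (isOptimalSavings_savings (smul_pos hθ hp) hr ha')
    ((isOptimalSavings_savings hp hr ha).smul hθ)

/-- Multiplication of wealth by `θ`. -/
def scaleEquiv (hθ : 0 < θ) : ℝ ≃ᵐ ℝ := (Homeomorph.mulLeft₀ θ hθ.ne').toMeasurableEquiv

lemma scaleEquiv_apply (hθ : 0 < θ) (a : ℝ) : scaleEquiv hθ a = θ * a := rfl

lemma preimage_wealthSet (hθ : 0 < θ) :
    scaleEquiv hθ ⁻¹' E.wealthSet (θ • p) r = E.wealthSet p r := by
  ext a
  exact mul_mem_wealthSet hθ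

lemma setIntegral_scale (hθ : 0 < θ) (μ : Measure ℝ) (f : ℝ → ℝ) :
    ∫ a in E.wealthSet (θ • p) r, f a ∂(μ.map (scaleEquiv hθ)) =
      ∫ a in E.wealthSet p r, f (θ * a) ∂μ := by
  rw [(scaleEquiv hθ).measurableEmbedding.setIntegral_map, preimage_wealthSet hθ]
  rfl

lemma IsInvariant.smul (hθ : 0 < θ) {g g' : ℝ → ℝ} {μ : Measure ℝ} (h : E.IsInvariant p r g μ)
    (hg : ∀ a ∈ E.wealthSet p r, g' (θ * a) = θ * g a) :
    E.IsInvariant (θ • p) r g' (μ.map (scaleEquiv hθ)) := by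
  have := h.prob
  refine ⟨Measure.isProbabilityMeasure_map (scaleEquiv hθ).measurable.aemeasurable, ?_, ?_⟩
  · rw [(scaleEquiv hθ).map_apply, preimage_compl, preimage_wealthSet hθ]
    exact h.support
  · intro D hD hDA
    rw [(scaleEquiv hθ).map_apply, h.invariant _ ((scaleEquiv hθ).measurable hD)
      ((preimage_mono hDA).trans (preimage_wealthSet hθ).subset), (scaleEquiv hθ).restrict_map,
      lintegral_map_equiv, preimage_wealthSet hθ]
    refine setLIntegral_congr_fun measurableSet_Icc fun a ha => ?_
    refine Finset.sum_congr rfl fun y _ => ?_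
    rw [scaleEquiv_apply, hg a ha, smul_dotProduct, smul_eq_mul,
      show (1 + r) * (θ * g a) + θ * p ⬝ᵥ y = scaleEquiv hθ ((1 + r) * g a + p ⬝ᵥ y) by
        rw [scaleEquiv_apply]; ring]
    rfl

lemma invariantDist_smul (hθ : 0 < θ) (hp : ∀ i, 0 < p i) (hr : 0 < r) :
    E.invariantDist (θ • p) r = (E.invariantDist p r).map (scaleEquiv hθ) :=
  (existsUnique_isInvariant (smul_pos hθ hp) hr).unique
    (isInvariant_invariantDist (smul_pos hθ hp) hr)
    ((isInvariant_invariantDist hp hr).smul hθ fun _ ha => savings_smul hθ hp hr ha.1)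

lemma demand_savings_smul (hθ : 0 < θ) (hp : ∀ i, 0 < p i) (hr : 0 < r) {a : ℝ}
    (ha : E.minWealth p r ≤ a) : demand E.U (θ * a - E.savings (θ * a) (θ • p) r) (θ • p) =
      demand E.U (a - E.savings a p r) p := by
  rw [savings_smul hθ hp hr ha, ← mul_sub, demand_smul hθ]

lemma excessGood_smul (hθ : 0 < θ) (hp : ∀ i, 0 < p i) (hr : 0 < r) (i : Fin n) :
    E.excessGood i (θ • p) r = E.excessGood i p r := by
  rw [excessGood, excessGood, invariantDist_smul hθ hp hr, setIntegral_scale hθ]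
  congr 1
  exact setIntegral_congr_fun measurableSet_Icc fun a ha =>
    congrFun (demand_savings_smul hθ hp hr ha.1) i

lemma excessSavings_smul (hθ : 0 < θ) (hp : ∀ i, 0 < p i) (hr : 0 < r) :
    E.excessSavings (θ • p) r = θ * E.excessSavings p r := by
  rw [excessSavings, excessSavings, invariantDist_smul hθ hp hr, setIntegral_scale hθ, mul_neg,
    ← integral_const_mul]
  congr 1
  exact setIntegral_congr_fun measurableSet_Icc fun a ha => savings_smul hθ hp hr ha.1

/-- The given policy, demand and distribution are transported directly, so they need not be the
canonical ones. -/
lemma IsCSE.smul (hθ : 0 < θ) {g : ℝ → ℝ} {x : ℝ → (Fin n → ℝ)} {μ : Measure ℝ}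
    (h : E.IsCSE p r g x μ) : E.IsCSE (θ • p) r (fun a => θ * g (θ⁻¹ * a))
      (fun c => x (θ⁻¹ * c)) (μ.map (scaleEquiv hθ)) := by
  have hx : ∀ a, θ⁻¹ * (θ * a - θ * g a) = a - g a := fun a => by
    rw [← mul_sub, inv_mul_cancel_left₀ hθ.ne']
  refine ⟨fun a ha => ?_, fun a ha => ?_, ?_, fun i => ?_, ?_⟩
  · have := (h.savings_optimal _ ((inv_mul_mem_wealthSet hθ).2 ha)).smul hθ
    rwa [mul_inv_cancel_left₀ hθ.ne'] at this
  · have := h.demand_optimal _ ((inv_mul_mem_wealthSet hθ).2 ha)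
    rw [← isOptimalBundle_smul hθ, mul_sub, mul_inv_cancel_left₀ hθ.ne'] at this
    simp only [mul_sub, inv_mul_cancel_left₀ hθ.ne']
    exact this
  · exact h.invariant.smul hθ fun a _ => by simp only [inv_mul_cancel_left₀ hθ.ne']
  · rw [setIntegral_scale hθ, ← h.goods_clear i]
    simp only [inv_mul_cancel_left₀ hθ.ne', hx]
  · rw [setIntegral_scale hθ]
    simp only [inv_mul_cancel_left₀ hθ.ne']
    rw [integral_const_mul, h.savings_clear, mul_zero]

lemma IsEquilibriumPrices.smul (hθ : 0 < θ) (h : E.IsEquilibriumPrices p r) :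
    E.IsEquilibriumPrices (θ • p) r := by
  obtain ⟨hp, hr0, hr1, g, x, μ, hcse⟩ := h
  exact ⟨smul_pos hθ hp, hr0, hr1, _, _, _, hcse.smul hθ⟩

end Economy

end Bewley

end

theorem proposition1 {n : ℕ} (E : Bewley.Economy n) (p : Fin n → ℝ) (hp : ∀ i, 0 < p i)
    (r : ℝ) (hr0 : 0 < r) (hr1 : r < 1) (θ : ℝ) (hθ : 0 < θ) :
    E.WellPosed p r ∧
    (∀ a : ℝ, E.minWealth p r ≤ a →
      θ * E.savings a p r = E.savings (θ * a) (θ • p) r ∧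
      Bewley.demand E.U (a - E.savings a p r) p =
        Bewley.demand E.U (θ * a - E.savings (θ * a) (θ • p) r) (θ • p)) ∧
    (∀ i : Fin n, E.excessGood i (θ • p) r = E.excessGood i p r) ∧
    E.excessSavings (θ • p) r = θ * E.excessSavings p r ∧
    (E.IsEquilibriumPrices p r → E.IsEquilibriumPrices (θ • p) r) :=
  ⟨Bewley.Economy.wellPosed hp hr0,
    fun _ ha => ⟨(Bewley.Economy.savings_smul hθ hp hr0 ha).symm,
      (Bewley.Economy.demand_savings_smul hθ hp hr0 ha).symm⟩,
    Bewley.Economy.excessGood_smul hθ hp hr0, Bewley.Economy.excessSavings_smul hθ hp hr0,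
    Bewley.Economy.IsEquilibriumPrices.smul hθ⟩
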